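/- Let $n\ge 0$ be an integer. Let $\mathbf R^{2m}$ carry the standard symplectic form $\omega_0=\sum_{i=1}^m dx_i\wedge dy_i$, and for $a>0$ let $B^{2m}(a)\subset\mathbf R^{2m}$ be the closed ball of capacity $a$ centred at the origin, that is, of radius $\sqrt{a/\pi}$ (for $m=0$ it is a point). Let $0<c<C$, and let $P_1,P_2\subset\mathbf R^2$ be two disjoint closed rectangles (in any position), $P_1$ of area $C-c$ and $P_2$ of area $c$. Let $L$ be a line segment joining a point of $P_1$ to a point of $P_2$, and put $$ Z_{C,c}=B^{2n}(C)\times P_1\;\cup\;B^{2n}(c)\times(L\cup P_2)\;\subset\;\mathbf R^{2n}\times\mathbf R^2=\mathbf R^{2n+2}. $$ Then for every neighbourhood $\mathcal N$ of $Z_{C,c}$ in $\mathbf R^{2n+2}$ there is a symplectic embedding $B^{2n+2}(C)\hookrightarrow\mathcal N$, that is, a smooth injective map $f$ with $f^*\omega_0=\omega_0$, defined on an open neighbourhood of $B^{2n+2}(C)$ in $\mathbf R^{2n+2}$ and with values in $\mathbf R^{2n+2}$, such that $f(B^{2n+2}(C))\subset\mathcal N$. -/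

import Mathlib

open scoped ContDiff Topology

namespace SymplecticBall

noncomputable section

/-- The Euclidean plane `ℝ²`. -/
abbrev Plane : Type := EuclideanSpace ℝ (Fin 2)

/-- The Euclidean space `ℝ²ⁿ`, with coordinates `x i = z (i, 0)` and `y i = z (i, 1)`. -/
abbrev Phase (n : ℕ) : Type := EuclideanSpace ℝ (Fin n × Fin 2)

/-- The standard symplectic form `∑ dx i ∧ dy i` on `ℝ²ⁿ`. -/
def omega {n : ℕ} (u v : Phase n) : ℝ :=
  ∑ i, (u (i, 0) * v (i, 1) - u (i, 1) * v (i, 0))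

/-- The standard closed ball in `ℝ²ⁿ` of capacity `a`, i.e. of radius `√(a / π)`. -/
def ball (n : ℕ) (a : ℝ) : Set (Phase n) :=
  Metric.closedBall 0 (Real.sqrt (a / Real.pi))

/-- The projection of `ℝ²ⁿ⁺² = ℝ²ⁿ × ℝ²` onto its first factor. -/
def fstProj {n : ℕ} (z : Phase (n + 1)) : Phase n :=
  WithLp.toLp 2 fun k => z (k.1.castSucc, k.2)

/-- The projection of `ℝ²ⁿ⁺² = ℝ²ⁿ × ℝ²` onto its second factor, the last two coordinates. -/
def sndProj {n : ℕ} (z : Phase (n + 1)) : Plane :=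
  WithLp.toLp 2 fun j => z (Fin.last n, j)

/-- The product `A × P ⊆ ℝ²ⁿ × ℝ² = ℝ²ⁿ⁺²`. -/
def prodSet {n : ℕ} (A : Set (Phase n)) (P : Set Plane) : Set (Phase (n + 1)) :=
  {z | fstProj z ∈ A ∧ sndProj z ∈ P}

/-- `P` is a closed nondegenerate rectangle in the plane, in any position: it has a corner `o`,
orthonormal edge directions `u`, `v` and side lengths `a, b > 0`. -/
def IsRectangle (P : Set Plane) : Prop :=
  ∃ (o u v : Plane) (a b : ℝ), ‖u‖ = 1 ∧ ‖v‖ = 1 ∧ inner ℝ u v = 0 ∧ 0 < a ∧ 0 < b ∧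
    P = {z | ∃ s ∈ Set.Icc 0 a, ∃ t ∈ Set.Icc 0 b, z = o + s • u + t • v}

/-- `f` restricts to a symplectic embedding of `S ⊆ ℝ²ⁿ` into `ℝ²ⁿ`: on some open neighbourhood of
`S` it is smooth, injective, and pulls the standard symplectic form back to itself. (Since
source and target have the same dimension, such a map is automatically an open embedding of that
neighbourhood.) -/
def IsSymplecticEmbeddingOn {n : ℕ} (f : Phase n → Phase n) (S : Set (Phase n)) : Prop :=
  ∃ U : Set (Phase n), IsOpen U ∧ S ⊆ U ∧ ContDiffOn ℝ ∞ f U ∧ Set.InjOn f U ∧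
    ∀ x ∈ U, ∀ u v : Phase n, omega (fderiv ℝ f x u) (fderiv ℝ f x v) = omega u v

/-- The set `B²ⁿ(C) × P₁ ∪ B²ⁿ(c) × (L ∪ P₂)` in `ℝ²ⁿ⁺²`. -/
def splitSet (n : ℕ) (C c : ℝ) (P₁ L P₂ : Set Plane) : Set (Phase (n + 1)) :=
  prodSet (ball n C) P₁ ∪ prodSet (ball n c) (L ∪ P₂)

end

end SymplecticBall

open scoped ContDiff Topology

namespace SymplecticBall

noncomputable section

/-! The embedding is the product of the identity of ℝ²ⁿ with an area preserving map σ of the plane,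
defined near the disc of area `C`. Suppose σ takes that disc into a small neighbourhood of P₁ ∪ L ∪
P₂, and the concentric disc of area `C - c` into one of P₁. For a point (w, z) of the ball, π|w|² +
π|z|² ≤ C. If z lies in the inner disc, then σ(z) is near P₁, and w ∈ B(C) always holds. If not,
π|w|² < c, so w ∈ B(c), and it does not matter near which part of the dumbbell σ(z) lies.

The map σ is found in two steps. `exists_diffeo_dumbbell` ignores area: it gives a diffeomorphism G
for which the image of one centred disc covers P₁ and stays near it, and the image of a larger one
covers P₁ ∪ P₂ and stays near the dumbbell. G inflates a disc about a point of P₁, stretches the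
outer collar along the segment, and inflates again inside P₂. Each move is the inverse of a cut-off
radial contraction of a convex polygon (`exists_diffeo_polytope`).

`exists_areaPreserving_of_diffeo` then corrects the area without changing the images of centred
discs. With J = det DG, the map M = `rearrange J` permutes centred circles, redistributing radius
and angle by J-mass, so that det DM = J. Hence σ = G ∘ M⁻¹ preserves area, and it sends a disc of
area A into the image under G of a centred disc as soon as that image has area at least A. The areas
of the rectangles provide exactly this for `C - c` and `C`. M is smooth at the origin because G is
affine there. -/

/-- The standard area form on the plane. -/
def wedge (u v : Plane) : ℝ := u 0 * v 1 - u 1 * v 0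

/-- In dimension two symplectic means determinant one; this is how the area condition on σ enters
the symplectic form. -/
theorem wedge_map (A : Plane →L[ℝ] Plane) (u v : Plane) :
    wedge (A u) (A v) = A.det * wedge u v := by
  let b := (EuclideanSpace.basisFun (Fin 2) ℝ).toBasis
  have hdet : A.det = A (b 0) 0 * A (b 1) 1 - A (b 1) 0 * A (b 0) 1 := by
    rw [ContinuousLinearMap.det, ← LinearMap.det_toMatrix b, Matrix.det_fin_two]
    simp [LinearMap.toMatrix_apply, b]
  have hexp : ∀ w : Plane, w = w 0 • b 0 + w 1 • b 1 := fun w => by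
    have := (b.sum_repr w).symm
    simpa [Fin.sum_univ_two, b] using this
  have hA : ∀ (w : Plane) (i : Fin 2), A w i = w 0 * A (b 0) i + w 1 * A (b 1) i := fun w i => by
    conv_lhs => rw [hexp w]
    simp
  simp only [wedge, hdet, hA u, hA v]
  ring

theorem det_eq_wedge (A : Plane →L[ℝ] Plane) : A.det = wedge (A !₂[1, 0]) (A !₂[0, 1]) := by
  rw [wedge_map]; simp [wedge]

theorem det_comp {V : Type*} [NormedAddCommGroup V] [NormedSpace ℝ V] (A B : V →L[ℝ] V) :
    (A.comp B).det = A.det * B.det := by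
  simp only [ContinuousLinearMap.det, ContinuousLinearMap.toLinearMap_comp, LinearMap.det_comp]

/-! ### Inverses of smooth maps with invertible derivative -/

section Inverse

variable {V : Type*} [NormedAddCommGroup V] [NormedSpace ℝ V] [FiniteDimensional ℝ V]

/-- A local right inverse of a smooth map at a point where its derivative is invertible. -/
theorem exists_smooth_local_right_inverse {f : V → V} {x : V} (hf : ContDiffAt ℝ ∞ f x)
    (hdet : (fderiv ℝ f x).det ≠ 0) :
    ∃ g : V → V, ContDiffAt ℝ ∞ g (f x) ∧ g (f x) = x ∧ ∀ᶠ y in 𝓝 (f x), f (g y) = y := by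
  have : CompleteSpace V := FiniteDimensional.complete ℝ V
  have h1 : HasFDerivAt f
      ((fderiv ℝ f x).toContinuousLinearEquivOfDetNeZero hdet : V →L[ℝ] V) x := by
    rw [ContinuousLinearMap.coe_toContinuousLinearEquivOfDetNeZero]
    exact (hf.differentiableAt (by simp)).hasFDerivAt
  have hs := hf.hasStrictFDerivAt' h1 (by simp)
  exact ⟨hf.localInverse h1 (by simp), hf.to_localInverse h1 (by simp),
    hf.localInverse_apply_image h1 (by simp), hs.eventually_right_inverse⟩

theorem image_mem_nhds_of_det_ne_zero {f : V → V} {x : V} (hf : ContDiffAt ℝ ∞ f x)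
    (hdet : (fderiv ℝ f x).det ≠ 0) {s : Set V} (hs : s ∈ 𝓝 x) : f '' s ∈ 𝓝 (f x) := by
  obtain ⟨g, hg, hgx, hfg⟩ := exists_smooth_local_right_inverse hf hdet
  have : g ⁻¹' s ∈ 𝓝 (f x) := hg.continuousAt.preimage_mem_nhds (by rwa [hgx])
  filter_upwards [this, hfg] with y hy hy'
  exact ⟨g y, hy, hy'⟩

/-- No continuity of `g` is needed: for a smooth local right inverse `l`, g(y) = g(f(l y)) = l y
near `f x`. -/
theorem contDiffAt_leftInverse {f g : V → V} (hgf : Function.LeftInverse g f) {x : V}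
    (hf : ContDiffAt ℝ ∞ f x) (hdet : (fderiv ℝ f x).det ≠ 0) : ContDiffAt ℝ ∞ g (f x) := by
  obtain ⟨l, hl, -, hfl⟩ := exists_smooth_local_right_inverse hf hdet
  refine hl.congr_of_eventuallyEq ?_
  filter_upwards [hfl] with y hy
  rw [← hy, hgf, hy]

theorem det_fderiv_leftInverse {f g : V → V} (hgf : Function.LeftInverse g f) {x : V}
    (hf : ContDiffAt ℝ ∞ f x) (hdet : (fderiv ℝ f x).det ≠ 0) :
    (fderiv ℝ g (f x)).det * (fderiv ℝ f x).det = 1 := by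
  have hg := contDiffAt_leftInverse hgf hf hdet
  rw [← det_comp, ← fderiv_comp x (hg.differentiableAt (by simp)) (hf.differentiableAt (by simp)),
    hgf.comp_eq_id, fderiv_id, ContinuousLinearMap.det]
  simp

end Inverse

/-! ### Smoothness of integrals in a parameter -/

section Parametric

theorem continuous_integral_param {E F : Type*} [NormedAddCommGroup E]
    [NormedAddCommGroup F] [NormedSpace ℝ F] {f : E × ℝ → F} (hf : Continuous f) (a b : ℝ) :
    Continuous fun x => ∫ t in a..b, f (x, t) :=
  intervalIntegral.continuous_parametric_intervalIntegral_of_continuous' (f := fun x t => f (x, t))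
    hf a b

variable {E : Type} [NormedAddCommGroup E] [NormedSpace ℝ E]

theorem hasFDerivAt_integral_param [ProperSpace E] {F : Type} [NormedAddCommGroup F]
    [NormedSpace ℝ F] [CompleteSpace F]
    {f : E × ℝ → F} (hf : ContDiff ℝ 1 f) (a b : ℝ) (x : E) :
    HasFDerivAt (fun x => ∫ t in a..b, f (x, t))
      (∫ t in a..b, (fderiv ℝ f (x, t)).comp (ContinuousLinearMap.inl ℝ E ℝ)) x := by
  have hc : Continuous fun z : E × ℝ => (fderiv ℝ f z).comp (ContinuousLinearMap.inl ℝ E ℝ) :=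
    (hf.continuous_fderiv (by simp)).clm_comp continuous_const
  obtain ⟨B, hB⟩ := ((isCompact_closedBall x 1).prod (isCompact_uIcc (a := a) (b := b)))
    |>.exists_bound_of_continuousOn hc.continuousOn
  have := hf.continuous
  refine intervalIntegral.hasFDerivAt_integral_of_dominated_of_fderiv_le
    (F := fun x t => f (x, t)) (bound := fun _ => B)
    (F' := fun x t => (fderiv ℝ f (x, t)).comp (ContinuousLinearMap.inl ℝ E ℝ))
    (Metric.ball_mem_nhds x one_pos) ?_ ?_ ?_ ?_ ?_ ?_
  · exact .of_forall fun y => (by fun_prop : Continuous fun t => f (y, t)).aestronglyMeasurable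
  · exact (by fun_prop : Continuous fun t => f (x, t)).intervalIntegrable _ _
  · exact (hc.comp (by fun_prop : Continuous fun t : ℝ => (x, t))).aestronglyMeasurable
  · refine .of_forall fun t ht y hy => hB (y, t) ⟨Metric.ball_subset_closedBall hy, ?_⟩
    exact Set.uIoc_subset_uIcc ht
  · exact intervalIntegrable_const
  · refine .of_forall fun t _ y _ => ?_
    have h1 := ((hf.differentiable (by simp)) (y, t)).hasFDerivAt
    exact h1.comp y (hasFDerivAt_prodMk_left y t)

/-- The target space varies in the induction, since the derivative is a parametric integral with
values in `E →L[ℝ] F`. -/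
theorem contDiff_integral_param_nat [ProperSpace E] (n : ℕ) : ∀ {F : Type} [NormedAddCommGroup F]
    [NormedSpace ℝ F] [CompleteSpace F] {f : E × ℝ → F}, ContDiff ℝ ∞ f → ∀ a b : ℝ,
    ContDiff ℝ n fun x => ∫ t in a..b, f (x, t) := by
  induction n with
  | zero => exact fun hf a b => contDiff_zero.2 (continuous_integral_param hf.continuous a b)
  | succ n ih =>
    intro F _ _ _ f hf a b
    have hd := hasFDerivAt_integral_param (hf.of_le (by exact_mod_cast le_top)) a b
    refine contDiff_succ_iff_hasFDerivAt.2 ⟨_, ?_, hd⟩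
    exact ih (f := fun z => (fderiv ℝ f z).comp (ContinuousLinearMap.inl ℝ E ℝ))
      ((hf.fderiv_right (by simp)).clm_comp contDiff_const) a b

/-- Integrals over a compact interval depend smoothly on parameters. -/
theorem contDiff_integral_param [ProperSpace E] {F : Type} [NormedAddCommGroup F]
    [NormedSpace ℝ F] [CompleteSpace F] {f : E × ℝ → F} (hf : ContDiff ℝ ∞ f) (a b : ℝ) :
    ContDiff ℝ ∞ fun x => ∫ t in a..b, f (x, t) :=
  contDiff_infty.2 fun n => contDiff_integral_param_nat n hf a b

end Parametric

/-! ### Polar coordinates and rearrangement of a density along centred circles -/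

section Polar

/-- Polar coordinates: `(R, θ) ↦ (R cos θ, R sin θ)`. -/
def polar (x : Plane) : Plane := !₂[x 0 * Real.cos (x 1), x 0 * Real.sin (x 1)]

/-- The polar angle of a point of the plane. -/
def angle (z : Plane) : ℝ := Complex.arg ⟨z 0, z 1⟩

theorem contDiff_coord (i : Fin 2) : ContDiff ℝ ∞ fun x : Plane => x i :=
  (EuclideanSpace.proj i : Plane →L[ℝ] ℝ).contDiff

theorem contDiff_mk {E : Type*} [NormedAddCommGroup E] [NormedSpace ℝ E] {n : WithTop ℕ∞}
    {f g : E → ℝ} (hf : ContDiff ℝ n f)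
    (hg : ContDiff ℝ n g) : ContDiff ℝ n fun x => (!₂[f x, g x] : Plane) := by
  refine contDiff_euclidean.2 fun i => ?_
  fin_cases i
  · exact hf
  · exact hg

theorem contDiff_polar : ContDiff ℝ ∞ polar :=
  contDiff_mk ((contDiff_coord 0).mul (Real.contDiff_cos.comp (contDiff_coord 1)))
    ((contDiff_coord 0).mul (Real.contDiff_sin.comp (contDiff_coord 1)))

theorem norm_sq_plane (z : Plane) : ‖z‖ ^ 2 = z 0 ^ 2 + z 1 ^ 2 := by
  simp [EuclideanSpace.norm_sq_eq, Fin.sum_univ_two]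

theorem norm_polar (x : Plane) : ‖polar x‖ = |x 0| := by
  rw [← abs_norm (polar x), ← sq_eq_sq_iff_abs_eq_abs, norm_sq_plane]
  simp only [polar, PiLp.toLp_apply, Matrix.cons_val_zero, Matrix.cons_val_one]
  linear_combination x 0 ^ 2 * Real.cos_sq_add_sin_sq (x 1)

theorem polar_norm_angle (z : Plane) : polar !₂[‖z‖, angle z] = z := by
  have h : ‖(⟨z 0, z 1⟩ : ℂ)‖ = ‖z‖ := by
    rw [← abs_norm z, ← abs_norm (_ : ℂ), ← sq_eq_sq_iff_abs_eq_abs, norm_sq_plane,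
      ← Complex.normSq_eq_norm_sq, Complex.normSq_mk]
    ring
  ext i
  fin_cases i
  · simpa [polar, angle, h] using Complex.norm_mul_cos_arg ⟨z 0, z 1⟩
  · simpa [polar, angle, h] using Complex.norm_mul_sin_arg ⟨z 0, z 1⟩

theorem polar_add_int (R θ : ℝ) (k : ℤ) : polar !₂[R, θ + k • (2 * Real.pi)] = polar !₂[R, θ] := by
  simp [polar, Real.cos_add_int_mul_two_pi, Real.sin_add_int_mul_two_pi]

theorem exists_int_of_polar_eq {R θ θ' : ℝ} (hR : R ≠ 0) (h : polar !₂[R, θ] = polar !₂[R, θ']) :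
    ∃ k : ℤ, θ = θ' + k • (2 * Real.pi) := by
  have h0 : Real.cos θ = Real.cos θ' := by
    simpa [polar, hR] using congrArg (fun z : Plane => z 0) h
  have h1 : Real.sin θ = Real.sin θ' := by
    simpa [polar, hR] using congrArg (fun z : Plane => z 1) h
  obtain ⟨k, hk⟩ := Real.Angle.angle_eq_iff_two_pi_dvd_sub.1 (Real.Angle.cos_sin_inj h0 h1)
  exact ⟨k, by rw [zsmul_eq_mul]; linarith⟩

theorem hasDerivAt_line_coord {f : Plane → Plane} {x : Plane} (hf : DifferentiableAt ℝ f x)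
    (v : Plane) (i : Fin 2) : HasDerivAt (fun t : ℝ => f (x + t • v) i) (fderiv ℝ f x v i) 0 := by
  have h1 : HasFDerivAt f (fderiv ℝ f x) (x + (0 : ℝ) • v) := by simpa using hf.hasFDerivAt
  have h2 : HasDerivAt (fun t : ℝ => x + t • v) v 0 := by
    simpa using ((hasDerivAt_id (0 : ℝ)).smul_const v).const_add x
  have h3 := h1.comp_hasDerivAt (0 : ℝ) h2
  exact ((EuclideanSpace.proj i : Plane →L[ℝ] ℝ).hasFDerivAt).comp_hasDerivAt (0 : ℝ) h3

theorem det_fderiv_polar (x : Plane) : (fderiv ℝ polar x).det = x 0 := by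
  have hd : DifferentiableAt ℝ polar x := contDiff_polar.differentiable (by simp) x
  have hl : HasDerivAt (fun t : ℝ => x 0 + t) 1 0 := (hasDerivAt_id (0 : ℝ)).const_add _
  have hl' : HasDerivAt (fun t : ℝ => x 1 + t) 1 0 := (hasDerivAt_id (0 : ℝ)).const_add _
  have e00 := (hasDerivAt_line_coord hd !₂[1, 0] 0).unique
    (by simpa [polar] using hl.mul_const (Real.cos (x 1)))
  have e01 := (hasDerivAt_line_coord hd !₂[1, 0] 1).unique
    (by simpa [polar] using hl.mul_const (Real.sin (x 1)))
  have e10 := (hasDerivAt_line_coord hd !₂[0, 1] 0).unique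
    (by simpa [polar] using hl'.cos.const_mul (x 0))
  have e11 := (hasDerivAt_line_coord hd !₂[0, 1] 1).unique
    (by simpa [polar] using hl'.sin.const_mul (x 0))
  rw [det_eq_wedge, wedge, e00, e01, e10, e11]
  linear_combination x 0 * Real.cos_sq_add_sin_sq (x 1)

/-- The integral of `J` over the arc of radius `R` between the angles `0` and `θ`. -/
def arcIntegral (J : Plane → ℝ) (R θ : ℝ) : ℝ := ∫ t in (0 : ℝ)..θ, J (polar !₂[R, t])

/-- The integral of `J` over the disc of radius `R`, in polar coordinates. -/
def discIntegral (J : Plane → ℝ) (R : ℝ) : ℝ :=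
  ∫ s in (0 : ℝ)..R, s * arcIntegral J s (2 * Real.pi)

/-- The radius of the disc whose area is the `J`-area of the disc of radius `R`. -/
def newRadius (J : Plane → ℝ) (R : ℝ) : ℝ := Real.sqrt (discIntegral J R / Real.pi)

/-- The angle at which the arc from `0` has the same share of its circle as the arc of radius `R`
from `0` to `θ` with respect to the density `J`. -/
def newAngle (J : Plane → ℝ) (R θ : ℝ) : ℝ :=
  2 * Real.pi * (arcIntegral J R θ / arcIntegral J R (2 * Real.pi))

/-- The rearrangement of the plane, preserving the family of centred circles, that takes the
density `J` to the standard one. -/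
def rearrange (J : Plane → ℝ) (z : Plane) : Plane :=
  polar !₂[newRadius J ‖z‖, newAngle J ‖z‖ (angle z)]

variable {J : Plane → ℝ}

theorem continuous_circle (hJ : Continuous J) (R : ℝ) : Continuous fun t => J (polar !₂[R, t]) :=
  hJ.comp (contDiff_polar.continuous.comp (contDiff_mk (n := 0) contDiff_const contDiff_id).continuous)

theorem contDiff_arcIntegral (hJ : ContDiff ℝ ∞ J) :
    ContDiff ℝ ∞ fun x : Plane => arcIntegral J (x 0) (x 1) := by
  -- Rescaling by the angle fixes the interval of integration, so that the endpoint becomes a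
  -- parameter.
  have h : (fun x : Plane => arcIntegral J (x 0) (x 1)) =
      fun x => x 1 * ∫ s in (0 : ℝ)..1, J (polar !₂[x 0, x 1 * s]) := by
    funext x
    have := intervalIntegral.smul_integral_comp_mul_left (a := 0) (b := 1)
      (fun t => J (polar !₂[x 0, t])) (x 1)
    simpa [arcIntegral] using this.symm
  rw [h]
  refine (contDiff_coord 1).mul (contDiff_integral_param
    (f := fun y : Plane × ℝ => J (polar !₂[y.1 0, y.1 1 * y.2])) ?_ 0 1)
  refine hJ.comp (contDiff_polar.comp (contDiff_mk ((contDiff_coord 0).comp contDiff_fst) ?_))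
  exact ((contDiff_coord 1).comp contDiff_fst).mul contDiff_snd

theorem hasDerivAt_arcIntegral (hJ : Continuous J) (R θ : ℝ) :
    HasDerivAt (arcIntegral J R) (J (polar !₂[R, θ])) θ :=
  ((continuous_circle hJ R).integral_hasStrictDerivAt 0 θ).hasDerivAt

theorem strictMono_arcIntegral (hJ : Continuous J) (hpos : ∀ z, 0 < J z) (R : ℝ) :
    StrictMono (arcIntegral J R) :=
  strictMono_of_deriv_pos fun θ => by rw [(hasDerivAt_arcIntegral hJ R θ).deriv]; exact hpos _

theorem arcIntegral_zero (R : ℝ) : arcIntegral J R 0 = 0 := by simp [arcIntegral]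

theorem arcIntegral_two_pi_pos (hJ : Continuous J) (hpos : ∀ z, 0 < J z) (R : ℝ) :
    0 < arcIntegral J R (2 * Real.pi) := by
  simpa [arcIntegral_zero] using strictMono_arcIntegral hJ hpos R Real.two_pi_pos

theorem arcIntegral_add_int (hJ : Continuous J) (R θ : ℝ) (k : ℤ) :
    arcIntegral J R (θ + k • (2 * Real.pi)) =
      arcIntegral J R θ + k * arcIntegral J R (2 * Real.pi) := by
  have hper : Function.Periodic (fun t => J (polar !₂[R, t])) (2 * Real.pi) := fun t => by
    have := polar_add_int R t 1
    simp only [one_smul] at this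
    simp [this]
  have hi : ∀ a b, IntervalIntegrable (fun t => J (polar !₂[R, t])) MeasureTheory.volume a b :=
    fun a b => (continuous_circle hJ R).intervalIntegrable a b
  rw [arcIntegral, ← intervalIntegral.integral_add_adjacent_intervals (hi 0 θ) (hi θ _),
    hper.intervalIntegral_add_zsmul_eq k θ hi, hper.intervalIntegral_add_eq θ 0]
  simp [arcIntegral]

theorem contDiff_arcIntegral_two_pi (hJ : ContDiff ℝ ∞ J) :
    ContDiff ℝ ∞ fun R => arcIntegral J R (2 * Real.pi) :=
  (contDiff_arcIntegral hJ).comp (contDiff_mk contDiff_id contDiff_const)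

theorem hasDerivAt_discIntegral (hJ : ContDiff ℝ ∞ J) (R : ℝ) :
    HasDerivAt (discIntegral J) (R * arcIntegral J R (2 * Real.pi)) R :=
  ((continuous_id.mul (contDiff_arcIntegral_two_pi hJ).continuous).integral_hasStrictDerivAt 0
    R).hasDerivAt

theorem contDiff_discIntegral (hJ : ContDiff ℝ ∞ J) : ContDiff ℝ ∞ (discIntegral J) := by
  refine contDiff_infty_iff_deriv.2
    ⟨fun R => (hasDerivAt_discIntegral hJ R).differentiableAt, ?_⟩
  rw [funext fun R => (hasDerivAt_discIntegral hJ R).deriv]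
  exact contDiff_id.mul (contDiff_arcIntegral_two_pi hJ)

theorem discIntegral_zero : discIntegral J 0 = 0 := by simp [discIntegral]

theorem strictMonoOn_discIntegral (hJ : ContDiff ℝ ∞ J) (hpos : ∀ z, 0 < J z) :
    StrictMonoOn (discIntegral J) (Set.Ici 0) := by
  refine strictMonoOn_of_deriv_pos (convex_Ici 0) (contDiff_discIntegral hJ).continuous.continuousOn
    fun R hR => ?_
  rw [interior_Ici, Set.mem_Ioi] at hR
  rw [(hasDerivAt_discIntegral hJ R).deriv]
  exact mul_pos hR (arcIntegral_two_pi_pos hJ.continuous hpos R)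

theorem discIntegral_pos (hJ : ContDiff ℝ ∞ J) (hpos : ∀ z, 0 < J z) {R : ℝ} (hR : 0 < R) :
    0 < discIntegral J R := by
  simpa [discIntegral_zero] using
    strictMonoOn_discIntegral hJ hpos Set.self_mem_Ici (Set.mem_Ici.2 hR.le) hR

theorem newRadius_zero : newRadius J 0 = 0 := by simp [newRadius, discIntegral_zero]

theorem newRadius_nonneg (R : ℝ) : 0 ≤ newRadius J R := Real.sqrt_nonneg _

theorem newRadius_pos (hJ : ContDiff ℝ ∞ J) (hpos : ∀ z, 0 < J z) {R : ℝ} (hR : 0 < R) :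
    0 < newRadius J R :=
  Real.sqrt_pos.2 (div_pos (discIntegral_pos hJ hpos hR) Real.pi_pos)

theorem strictMonoOn_newRadius (hJ : ContDiff ℝ ∞ J) (hpos : ∀ z, 0 < J z) :
    StrictMonoOn (newRadius J) (Set.Ici 0) := by
  intro a ha b hb hab
  have h := strictMonoOn_discIntegral hJ hpos ha hb hab
  have h0 : 0 ≤ discIntegral J a := by
    simpa [discIntegral_zero] using
      (strictMonoOn_discIntegral hJ hpos).monotoneOn Set.self_mem_Ici ha ha
  exact Real.sqrt_lt_sqrt (div_nonneg h0 Real.pi_pos.le) (div_lt_div_of_pos_right h Real.pi_pos)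

theorem continuous_newRadius (hJ : ContDiff ℝ ∞ J) : Continuous (newRadius J) :=
  ((contDiff_discIntegral hJ).continuous.div_const _).sqrt

theorem hasDerivAt_newRadius (hJ : ContDiff ℝ ∞ J) (hpos : ∀ z, 0 < J z) {R : ℝ} (hR : 0 < R) :
    HasDerivAt (newRadius J)
      (R * arcIntegral J R (2 * Real.pi) / Real.pi / (2 * newRadius J R)) R :=
  ((hasDerivAt_discIntegral hJ R).div_const _).sqrt
    (div_pos (discIntegral_pos hJ hpos hR) Real.pi_pos).ne'

theorem newAngle_add_int (hJ : Continuous J) (hpos : ∀ z, 0 < J z) (R θ : ℝ) (k : ℤ) :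
    newAngle J R (θ + k • (2 * Real.pi)) = newAngle J R θ + k • (2 * Real.pi) := by
  have := (arcIntegral_two_pi_pos hJ hpos R).ne'
  rw [newAngle, newAngle, arcIntegral_add_int hJ, zsmul_eq_mul]
  field_simp

theorem strictMono_newAngle (hJ : Continuous J) (hpos : ∀ z, 0 < J z) (R : ℝ) :
    StrictMono (newAngle J R) := fun _ _ h =>
  mul_lt_mul_of_pos_left (div_lt_div_of_pos_right (strictMono_arcIntegral hJ hpos R h)
    (arcIntegral_two_pi_pos hJ hpos R)) Real.two_pi_pos

theorem hasDerivAt_newAngle (hJ : Continuous J) (R θ : ℝ) :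
    HasDerivAt (newAngle J R)
      (2 * Real.pi * (J (polar !₂[R, θ]) / arcIntegral J R (2 * Real.pi))) θ :=
  ((hasDerivAt_arcIntegral hJ R θ).div_const _).const_mul _

theorem surjective_newAngle (hJ : Continuous J) (hpos : ∀ z, 0 < J z) (R : ℝ) :
    Function.Surjective (newAngle J R) := by
  have hc : Continuous (newAngle J R) :=
    continuous_iff_continuousAt.2 fun θ => (hasDerivAt_newAngle hJ R θ).continuousAt
  have h0 : newAngle J R 0 = 0 := by simp [newAngle, arcIntegral_zero]
  intro φ
  obtain ⟨k, hk⟩ := exists_int_gt (|φ| / (2 * Real.pi))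
  rw [div_lt_iff₀ Real.two_pi_pos] at hk
  have e : ∀ m : ℤ, newAngle J R (m • (2 * Real.pi)) = m • (2 * Real.pi) := fun m => by
    simpa [h0] using newAngle_add_int hJ hpos R 0 m
  refine mem_range_of_exists_le_of_exists_ge hc ⟨(-k) • (2 * Real.pi), ?_⟩ ⟨k • (2 * Real.pi), ?_⟩
  · rw [e, neg_smul, zsmul_eq_mul]; linarith [neg_abs_le φ]
  · rw [e, zsmul_eq_mul]; linarith [le_abs_self φ]

/-- The new angle commutes with full turns, so any polar angle may replace the chosen branch, and
the jump of `angle` leaves no trace. -/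
theorem rearrange_polar (hJ : Continuous J) (hpos : ∀ z, 0 < J z) {R : ℝ} (hR : 0 ≤ R) (θ : ℝ) :
    rearrange J (polar !₂[R, θ]) = polar !₂[newRadius J R, newAngle J R θ] := by
  have hn : ‖polar !₂[R, θ]‖ = R := by simp [norm_polar, abs_of_nonneg hR]
  rcases hR.eq_or_lt with rfl | hR
  · rw [rearrange, hn, newRadius_zero]; simp [polar]
  · have h := polar_norm_angle (polar !₂[R, θ])
    rw [hn] at h
    obtain ⟨k, hk⟩ := exists_int_of_polar_eq hR.ne' h
    rw [rearrange, hn, hk, newAngle_add_int hJ hpos, polar_add_int]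

theorem norm_rearrange (z : Plane) : ‖rearrange J z‖ = newRadius J ‖z‖ := by
  simp [rearrange, norm_polar, abs_of_nonneg (newRadius_nonneg _)]

theorem injective_rearrange (hJ : ContDiff ℝ ∞ J) (hpos : ∀ z, 0 < J z) :
    Function.Injective (rearrange J) := by
  intro z w h
  have hn : ‖z‖ = ‖w‖ := by
    have := congrArg norm h
    rw [norm_rearrange, norm_rearrange] at this
    exact (strictMonoOn_newRadius hJ hpos).injOn (norm_nonneg z) (norm_nonneg w) this
  rcases (norm_nonneg w).eq_or_lt with h0 | h0
  · rw [← h0, norm_eq_zero] at hn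
    rw [hn, norm_eq_zero.1 h0.symm]
  · rw [rearrange, rearrange, hn] at h
    obtain ⟨k, hk⟩ := exists_int_of_polar_eq (newRadius_pos hJ hpos h0).ne' h
    rw [← newAngle_add_int hJ.continuous hpos] at hk
    rw [← polar_norm_angle z, ← polar_norm_angle w, hn,
      (strictMono_newAngle hJ.continuous hpos _).injective hk, polar_add_int]

theorem image_closedBall_rearrange (hJ : ContDiff ℝ ∞ J) (hpos : ∀ z, 0 < J z) {R : ℝ}
    (hR : 0 ≤ R) :
    rearrange J '' Metric.closedBall 0 R = Metric.closedBall 0 (newRadius J R) := by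
  ext w
  simp only [Set.mem_image, mem_closedBall_zero_iff]
  constructor
  · rintro ⟨z, hz, rfl⟩
    rw [norm_rearrange]
    exact (strictMonoOn_newRadius hJ hpos).monotoneOn (norm_nonneg z) hR hz
  · intro hw
    obtain ⟨ρ, hρ, hρw⟩ : ‖w‖ ∈ newRadius J '' Set.Icc 0 R :=
      intermediate_value_Icc hR (continuous_newRadius hJ).continuousOn
        ⟨by rw [newRadius_zero]; exact norm_nonneg w, hw⟩
    obtain ⟨θ, hθ⟩ := surjective_newAngle hJ.continuous hpos ρ (angle w)
    refine ⟨polar !₂[ρ, θ], ?_, ?_⟩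
    · simpa [norm_polar, abs_of_nonneg hρ.1] using hρ.2
    · rw [rearrange_polar hJ.continuous hpos hρ.1, hρw, hθ, polar_norm_angle]

/-- The expression of `rearrange J` in polar coordinates. -/
def polarRearrange (J : Plane → ℝ) (x : Plane) : Plane :=
  !₂[newRadius J (x 0), newAngle J (x 0) (x 1)]

theorem contDiffAt_polarRearrange (hJ : ContDiff ℝ ∞ J) (hpos : ∀ z, 0 < J z) {x : Plane}
    (hx : 0 < x 0) : ContDiffAt ℝ ∞ (polarRearrange J) x := by
  refine contDiffAt_euclidean.2 fun i => ?_
  fin_cases i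
  · exact (((contDiff_discIntegral hJ).comp (contDiff_coord 0)).contDiffAt.div_const _).sqrt
      (div_pos (discIntegral_pos hJ hpos hx) Real.pi_pos).ne'
  · exact contDiffAt_const.mul ((contDiff_arcIntegral hJ).contDiffAt.div
      ((contDiff_arcIntegral_two_pi hJ).comp (contDiff_coord 0)).contDiffAt
      (arcIntegral_two_pi_pos hJ.continuous hpos _).ne')

/-- The Jacobian matrix is triangular. With ρ, φ the new radius and angle and m the J-integral over
the circle parameter, ρρ' = Rm/2π and ∂φ/∂θ = 2πJ/m, so m cancels. -/
theorem det_fderiv_polarRearrange (hJ : ContDiff ℝ ∞ J) (hpos : ∀ z, 0 < J z) {x : Plane}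
    (hx : 0 < x 0) :
    newRadius J (x 0) * (fderiv ℝ (polarRearrange J) x).det = x 0 * J (polar x) := by
  have hd := (contDiffAt_polarRearrange hJ hpos hx).differentiableAt (by simp)
  have hxx : !₂[x 0, x 1] = x := by ext i; fin_cases i <;> simp
  have hr := hasDerivAt_newRadius hJ hpos hx
  have ha := hasDerivAt_newAngle hJ.continuous (x 0) (x 1)
  rw [hxx] at ha
  rw [← add_zero (x 0)] at hr
  rw [← add_zero (x 1)] at ha
  have e00 := (hasDerivAt_line_coord hd !₂[1, 0] 0).unique
    (by simpa [polarRearrange] using hr.comp_const_add (x 0) 0)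
  have e10 := (hasDerivAt_line_coord hd !₂[0, 1] 0).unique
    (by simpa [polarRearrange] using hasDerivAt_const (0 : ℝ) (newRadius J (x 0)))
  have e11 := (hasDerivAt_line_coord hd !₂[0, 1] 1).unique
    (by simpa [polarRearrange] using ha.comp_const_add (x 1) 0)
  -- The radial derivative of the new angle is not computed: `e10` makes its coefficient zero.
  rw [det_eq_wedge, wedge, e00, e10, e11]
  have h1 := (newRadius_pos hJ hpos hx).ne'
  have h2 := (arcIntegral_two_pi_pos hJ.continuous hpos (x 0)).ne'
  have h3 := Real.pi_ne_zero
  field_simp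
  ring

theorem rearrange_comp_polar (hJ : ContDiff ℝ ∞ J) (hpos : ∀ z, 0 < J z) {x : Plane}
    (hx : 0 < x 0) : rearrange J ∘ polar =ᶠ[𝓝 x] polar ∘ polarRearrange J := by
  have : {y : Plane | 0 < y 0} ∈ 𝓝 x :=
    (isOpen_lt continuous_const (contDiff_coord 0).continuous).mem_nhds hx
  filter_upwards [this] with y hy
  have hyy : !₂[y 0, y 1] = y := by ext i; fin_cases i <;> simp
  have := rearrange_polar hJ.continuous hpos (le_of_lt hy) (y 1)
  rwa [hyy] at this

/-- Away from the origin `polar` has smooth local sections, which transfers smoothness from the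
polar expression; the chain rule on both sides of `rearrange_comp_polar` gives the determinant. -/
theorem contDiffAt_det_rearrange_of_ne_zero (hJ : ContDiff ℝ ∞ J) (hpos : ∀ z, 0 < J z)
    {z : Plane} (hz : z ≠ 0) :
    ContDiffAt ℝ ∞ (rearrange J) z ∧ (fderiv ℝ (rearrange J) z).det = J z := by
  obtain ⟨x, hx, rfl⟩ : ∃ x : Plane, 0 < x 0 ∧ polar x = z :=
    ⟨!₂[‖z‖, angle z], by simpa using hz, polar_norm_angle z⟩
  have hcomp := rearrange_comp_polar hJ hpos hx
  have hW := contDiffAt_polarRearrange hJ hpos hx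
  have hpdet : (fderiv ℝ polar x).det ≠ 0 := by rw [det_fderiv_polar]; exact hx.ne'
  have hsmooth : ContDiffAt ℝ ∞ (rearrange J) (polar x) := by
    obtain ⟨g, hg, hgx, hpg⟩ := exists_smooth_local_right_inverse contDiff_polar.contDiffAt hpdet
    have h1 : ContDiffAt ℝ ∞ ((polar ∘ polarRearrange J) ∘ g) (polar x) :=
      ContDiffAt.comp _ (by rw [hgx]; exact contDiff_polar.contDiffAt.comp _ hW) hg
    refine h1.congr_of_eventuallyEq ?_
    have h2 := hg.continuousAt.eventually (by rw [hgx]; exact hcomp)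
    filter_upwards [h2, hpg] with y hy hy'
    simp only [Function.comp_apply, hy'] at hy ⊢
    exact hy
  refine ⟨hsmooth, ?_⟩
  have h := congrArg ContinuousLinearMap.det (hcomp.fderiv_eq (𝕜 := ℝ))
  rw [fderiv_comp x (hsmooth.differentiableAt (by simp))
      (contDiff_polar.differentiable (by simp) x),
    fderiv_comp x (contDiff_polar.differentiable (by simp) _) (hW.differentiableAt (by simp)),
    det_comp, det_comp, det_fderiv_polar, det_fderiv_polar] at h
  have h' := det_fderiv_polarRearrange hJ hpos hx
  have h0 : polarRearrange J x 0 = newRadius J (x 0) := by simp [polarRearrange]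
  rw [h0, h', mul_comm] at h
  exact mul_left_cancel₀ hx.ne' h

theorem rearrange_eq_of_const {ρ c : ℝ} (hc : 0 < c) (hconst : ∀ z ∈ Metric.ball 0 ρ, J z = c)
    {z : Plane} (hz : z ∈ Metric.ball (0 : Plane) ρ) : rearrange J z = Real.sqrt c • z := by
  rw [mem_ball_zero_iff] at hz
  have harc : ∀ R, 0 ≤ R → R < ρ → ∀ θ, arcIntegral J R θ = c * θ := fun R hR hRρ θ => by
    have : ∀ t, J (polar !₂[R, t]) = c := fun t =>
      hconst _ (by simpa [norm_polar, abs_of_nonneg hR] using hRρ)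
    simp [arcIntegral, this, mul_comm]
  have hdisc : discIntegral J ‖z‖ = Real.pi * (c * ‖z‖ ^ 2) := by
    have : discIntegral J ‖z‖ = ∫ s in (0 : ℝ)..‖z‖, s * (c * (2 * Real.pi)) := by
      refine intervalIntegral.integral_congr fun s hs => ?_
      rw [Set.uIcc_of_le (norm_nonneg z)] at hs
      simp only [harc s hs.1 (hs.2.trans_lt hz)]
    rw [this, intervalIntegral.integral_mul_const, integral_id]
    ring
  have hr : newRadius J ‖z‖ = Real.sqrt c * ‖z‖ := by
    rw [newRadius, hdisc, mul_div_cancel_left₀ _ Real.pi_ne_zero, Real.sqrt_mul hc.le,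
      Real.sqrt_sq (norm_nonneg z)]
  have ha : newAngle J ‖z‖ (angle z) = angle z := by
    rw [newAngle, harc _ (norm_nonneg z) hz, harc _ (norm_nonneg z) hz]
    have := Real.pi_ne_zero
    field_simp
  rw [rearrange, hr, ha]
  conv_rhs => rw [← polar_norm_angle z]
  ext i
  fin_cases i <;> simp [polar, mul_assoc]

theorem det_smul_id (c : ℝ) : (c • ContinuousLinearMap.id ℝ Plane).det = c ^ 2 := by
  rw [det_eq_wedge]; simp [wedge, sq]

/-- Polar coordinates say nothing at the origin; a density constant there makes the rearrangement a
homothety nearby. -/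
theorem contDiffAt_det_rearrange (hJ : ContDiff ℝ ∞ J) (hpos : ∀ z, 0 < J z)
    (hconst : ∀ᶠ z in 𝓝 0, J z = J 0) (z : Plane) :
    ContDiffAt ℝ ∞ (rearrange J) z ∧ (fderiv ℝ (rearrange J) z).det = J z := by
  rcases eq_or_ne z 0 with rfl | hz
  · obtain ⟨ρ, hρ, hb⟩ := Metric.eventually_nhds_iff_ball.1 hconst
    have heq : rearrange J =ᶠ[𝓝 0] fun z => Real.sqrt (J 0) • z := by
      filter_upwards [Metric.ball_mem_nhds 0 hρ] with w hw
      exact rearrange_eq_of_const (hpos 0) hb hw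
    refine ⟨ContDiffAt.congr_of_eventuallyEq (by fun_prop) heq, ?_⟩
    have : HasFDerivAt (fun z : Plane => Real.sqrt (J 0) • z)
        (Real.sqrt (J 0) • ContinuousLinearMap.id ℝ Plane) 0 :=
      (Real.sqrt (J 0) • ContinuousLinearMap.id ℝ Plane).hasFDerivAt
    rw [heq.fderiv_eq, this.fderiv, det_smul_id, Real.sq_sqrt (hpos 0).le]
  · exact contDiffAt_det_rearrange_of_ne_zero hJ hpos hz

end Polar

/-! ### Diffeomorphisms of the plane -/

/-- An orientation preserving smooth diffeomorphism of the plane. -/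
structure IsDiffeo (e : Plane ≃ Plane) : Prop where
  contDiff : ContDiff ℝ ∞ e
  contDiff_symm : ContDiff ℝ ∞ e.symm
  det_pos : ∀ z, 0 < (fderiv ℝ e z).det

namespace IsDiffeo

variable {e f : Plane ≃ Plane}

theorem differentiable (he : IsDiffeo e) : Differentiable ℝ e :=
  he.contDiff.differentiable (by simp)

theorem trans (he : IsDiffeo e) (hf : IsDiffeo f) : IsDiffeo (e.trans f) where
  contDiff := hf.contDiff.comp he.contDiff
  contDiff_symm := he.contDiff_symm.comp hf.contDiff_symm
  det_pos z := by
    rw [Equiv.coe_trans, fderiv_comp z (hf.differentiable _) (he.differentiable _), det_comp]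
    exact mul_pos (hf.det_pos _) (he.det_pos _)

theorem of_contDiff (hc : ContDiff ℝ ∞ e) (hdet : ∀ z, 0 < (fderiv ℝ e z).det) : IsDiffeo e where
  contDiff := hc
  contDiff_symm := contDiff_iff_contDiffAt.2 fun y => by
    rw [← e.apply_symm_apply y]
    exact contDiffAt_leftInverse e.symm_apply_apply hc.contDiffAt (hdet _).ne'
  det_pos := hdet

theorem symm (he : IsDiffeo e) : IsDiffeo e.symm :=
  ⟨he.contDiff_symm, he.contDiff, fun y => by
    have h := det_fderiv_leftInverse e.symm_apply_apply (he.contDiff.contDiffAt (x := e.symm y))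
      (he.det_pos _).ne'
    rw [e.apply_symm_apply] at h
    exact (pos_iff_pos_of_mul_pos (h ▸ one_pos)).2 (he.det_pos _)⟩

theorem isOpen_image (he : IsDiffeo e) {s : Set Plane} (hs : IsOpen s) : IsOpen (e '' s) := by
  rw [e.image_eq_preimage_symm]
  exact hs.preimage he.contDiff_symm.continuous

theorem translation (a : Plane) : IsDiffeo (Equiv.addLeft a) where
  contDiff := contDiff_const.add contDiff_id
  contDiff_symm := contDiff_const.add contDiff_id
  det_pos z := by
    have : HasFDerivAt (Equiv.addLeft a) (ContinuousLinearMap.id ℝ Plane) z :=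
      (hasFDerivAt_id z).const_add a
    rw [this.fderiv, ContinuousLinearMap.det]
    simp

end IsDiffeo

/-- If e(z) were outside `W` it would be fixed, and injectivity would give e(z) = z. -/
theorem mapsTo_of_eq_outside {α : Type*} {e : α ≃ α} {W : Set α} (h : ∀ z ∉ W, e z = z) :
    Set.MapsTo e W W := by
  intro z hz
  by_contra hc
  exact hc ((e.injective (h _ hc)).symm ▸ hz)

/-! ### Cut-off radial contractions -/

section Contraction

/-- The map contracting the plane towards `z₀` by a factor between `1` and `κ`. -/
def contraction (z₀ : Plane) (κ : ℝ) (lam : Plane → ℝ) (z : Plane) : Plane :=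
  z₀ + (1 - (1 - κ) * lam z) • (z - z₀)

variable {z₀ : Plane} {κ : ℝ} {lam : Plane → ℝ}

theorem contDiff_contraction (hlam : ContDiff ℝ ∞ lam) : ContDiff ℝ ∞ (contraction z₀ κ lam) :=
  contDiff_const.add ((contDiff_const.sub (contDiff_const.mul hlam)).smul
    (contDiff_id.sub contDiff_const))

theorem le_contraction_factor (hκ1 : κ < 1) (hle : ∀ z, lam z ≤ 1) (z : Plane) :
    κ ≤ 1 - (1 - κ) * lam z := by
  nlinarith [hle z]

/-- Points with the same image lie on one ray from `z₀`. The scaling factor does not decrease along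
the ray, so the farther point cannot have the smaller factor. -/
theorem injective_contraction (hκ : 0 < κ) (hκ1 : κ < 1) (hle : ∀ z, lam z ≤ 1)
    (hanti : ∀ w, AntitoneOn (fun t : ℝ => lam (z₀ + t • w)) (Set.Ici 0)) :
    Function.Injective (contraction z₀ κ lam) := by
  intro z z' h
  have hm := hκ.trans_le (le_contraction_factor hκ1 hle z)
  have hm' := hκ.trans_le (le_contraction_factor hκ1 hle z')
  set m := 1 - (1 - κ) * lam z with hmdef
  set m' := 1 - (1 - κ) * lam z' with hmdef'
  have h1 : m • (z - z₀) = m' • (z' - z₀) := add_left_cancel h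
  have h2 : z' = z₀ + (m / m') • (z - z₀) := by
    rw [div_eq_inv_mul, mul_smul, h1, smul_smul, inv_mul_cancel₀ hm'.ne', one_smul,
      add_sub_cancel]
  have h3 : z = z₀ + (1 : ℝ) • (z - z₀) := by simp
  have hs : 0 < m / m' := div_pos hm hm'
  have hmm : m = m' := by
    rcases le_total (m / m') 1 with hs1 | hs1
    · have := hanti (z - z₀) hs.le (Set.mem_Ici.2 zero_le_one) hs1
      simp only [← h2, ← h3] at this
      refine le_antisymm ((div_le_one hm').1 hs1) ?_
      rw [hmdef, hmdef']; nlinarith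
    · have := hanti (z - z₀) (Set.mem_Ici.2 zero_le_one) hs.le hs1
      simp only [← h2, ← h3] at this
      refine le_antisymm ?_ ((one_le_div hm').1 hs1)
      rw [hmdef, hmdef']; nlinarith
  rw [h2, hmm, div_self hm'.ne', ← h3]

/-- Intermediate values on the ray through the target: the factor is at least κ, so going out to κ⁻¹
times its distance suffices. -/
theorem surjective_contraction (hlam : Continuous lam) (hκ : 0 < κ) (hκ1 : κ < 1)
    (hle : ∀ z, lam z ≤ 1) : Function.Surjective (contraction z₀ κ lam) := by
  intro y
  let g : ℝ → ℝ := fun t => (1 - (1 - κ) * lam (z₀ + t • (y - z₀))) * t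
  have hg : Continuous g := by fun_prop
  have h1 : (1 : ℝ) ≤ g κ⁻¹ := by
    calc (1 : ℝ) = κ * κ⁻¹ := (mul_inv_cancel₀ hκ.ne').symm
      _ ≤ _ := mul_le_mul_of_nonneg_right (le_contraction_factor hκ1 hle _) (inv_pos.2 hκ).le
  obtain ⟨t, -, ht⟩ := intermediate_value_Icc (inv_pos.2 hκ).le hg.continuousOn
    ⟨by simp [g], h1⟩
  refine ⟨z₀ + t • (y - z₀), ?_⟩
  rw [contraction, add_sub_cancel_left, smul_smul]
  change z₀ + g t • _ = y
  rw [ht, one_smul, add_sub_cancel]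

/-- With m the scaling factor, the derivative is m·id plus the rank one map (z - z₀) ⊗ dm, of
determinant m(m + dm(z - z₀)); the last term is nonnegative because `lam` decreases along rays. -/
theorem det_fderiv_contraction_pos (hlam : ContDiff ℝ ∞ lam) (hκ : 0 < κ) (hκ1 : κ < 1)
    (hle : ∀ z, lam z ≤ 1)
    (hanti : ∀ w, AntitoneOn (fun t : ℝ => lam (z₀ + t • w)) (Set.Ici 0)) (z : Plane) :
    0 < (fderiv ℝ (contraction z₀ κ lam) z).det := by
  have hl : HasFDerivAt lam (fderiv ℝ lam z) z :=
    (hlam.differentiable (by simp) z).hasFDerivAt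
  have hm : HasFDerivAt (fun z => 1 - (1 - κ) * lam z) (-((1 - κ) • fderiv ℝ lam z)) z :=
    (hl.const_mul (1 - κ)).const_sub 1
  have hk := (hm.smul ((hasFDerivAt_id z).sub_const z₀)).const_add z₀
  have hneg : fderiv ℝ lam z (z - z₀) ≤ 0 := by
    have h1 : HasDerivAt (fun t : ℝ => lam (z₀ + t • (z - z₀))) (fderiv ℝ lam z (z - z₀)) 1 := by
      have h2 : HasDerivAt (fun t : ℝ => z₀ + t • (z - z₀)) (z - z₀) 1 := by
        simpa using ((hasDerivAt_id (1 : ℝ)).smul_const (z - z₀)).const_add z₀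
      exact HasFDerivAt.comp_hasDerivAt (1 : ℝ) (by simpa using hl) h2
    have h3 := (hanti (z - z₀)).derivWithin_nonpos (x := 1)
    rwa [derivWithin_of_mem_nhds (Ici_mem_nhds one_pos), h1.deriv] at h3
  have hfac := hκ.trans_le (le_contraction_factor hκ1 hle z)
  have hexp : ∀ A : Plane →L[ℝ] ℝ, ∀ w : Plane, A w = w 0 * A !₂[1, 0] + w 1 * A !₂[0, 1] := by
    intro A w
    have : w = w 0 • !₂[1, 0] + w 1 • !₂[0, 1] := by ext i; fin_cases i <;> simp
    conv_lhs => rw [this]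
    simp
  have hdet : (fderiv ℝ (contraction z₀ κ lam) z).det =
      (1 - (1 - κ) * lam z) *
        ((1 - (1 - κ) * lam z) - (1 - κ) * fderiv ℝ lam z (z - z₀)) := by
    have : fderiv ℝ (contraction z₀ κ lam) z = _ := hk.fderiv
    rw [det_eq_wedge, this, hexp _ (z - z₀)]
    simp [wedge]
    ring
  rw [hdet]
  refine mul_pos hfac ?_
  nlinarith

end Contraction

/-! ### Inflating a disc inside a polytope -/

section Polytope

variable {ι : Type*} [Fintype ι]

/-- A smooth function equal to `1` near the polytope `ℓ i ≤ d i` and to `0` where some `ℓ i` is at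
least `d i + ε`. -/
def polytopeCutoff (l : ι → Plane →L[ℝ] ℝ) (d : ι → ℝ) (ε : ℝ) (z : Plane) : ℝ :=
  ∏ i, Real.smoothTransition ((d i + ε - l i z) * (2 / ε))

variable {l : ι → Plane →L[ℝ] ℝ} {d : ι → ℝ} {ε : ℝ}

theorem contDiff_polytopeCutoff : ContDiff ℝ ∞ (polytopeCutoff l d ε) :=
  contDiff_prod fun i _ => Real.smoothTransition.contDiff.comp
    ((contDiff_const.sub (l i).contDiff).mul contDiff_const)

theorem polytopeCutoff_le_one (z : Plane) : polytopeCutoff l d ε z ≤ 1 :=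
  Finset.prod_le_one (fun _ _ => Real.smoothTransition.nonneg _)
    fun _ _ => Real.smoothTransition.le_one _

theorem polytopeCutoff_eq_one (hε : 0 < ε) {z : Plane} (hz : ∀ i, l i z ≤ d i + ε / 2) :
    polytopeCutoff l d ε z = 1 := by
  refine Finset.prod_eq_one fun i _ => Real.smoothTransition.one_of_one_le ?_
  rw [mul_div_assoc', le_div_iff₀ hε]
  linarith [hz i]

theorem polytopeCutoff_eq_zero (hε : 0 < ε) {z : Plane} (hz : ¬ ∀ i, l i z < d i + ε) :
    polytopeCutoff l d ε z = 0 := by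
  push Not at hz
  obtain ⟨i, hi⟩ := hz
  refine Finset.prod_eq_zero (Finset.mem_univ i) (Real.smoothTransition.zero_of_nonpos ?_)
  exact mul_nonpos_of_nonpos_of_nonneg (by linarith) (by positivity)

/-- Each factor is nonincreasing: it decreases if the ray goes towards the i-th wall, and is
constantly 1 if it goes away, since the ray starts inside. -/
theorem antitoneOn_polytopeCutoff (hε : 0 < ε) {z₀ : Plane} (hz₀ : ∀ i, l i z₀ ≤ d i) (w : Plane) :
    AntitoneOn (fun t : ℝ => polytopeCutoff l d ε (z₀ + t • w)) (Set.Ici 0) := by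
  intro s hs t ht hst
  refine Finset.prod_le_prod (fun _ _ => Real.smoothTransition.nonneg _) fun i _ => ?_
  simp only [map_add, map_smul, smul_eq_mul]
  rcases le_total 0 (l i w) with h | h
  · refine Real.smoothTransition.monotone (mul_le_mul_of_nonneg_right ?_ (by positivity))
    nlinarith
  · rw [Real.smoothTransition.one_of_one_le (x := (d i + ε - (l i z₀ + s * l i w)) * (2 / ε))]
    · exact Real.smoothTransition.le_one _
    · rw [mul_div_assoc', le_div_iff₀ hε]
      nlinarith [hz₀ i, mul_nonpos_of_nonneg_of_nonpos (Set.mem_Ici.1 hs) h]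

/-- A small disc about a point of a compact polytope can be inflated to engulf the polytope, by a
diffeomorphism supported near the polytope and affine near the centre of the disc. -/
theorem exists_diffeo_polytope (hε : 0 < ε) (hb : Bornology.IsBounded {z | ∀ i, l i z ≤ d i})
    {z₀ : Plane} (hz₀ : ∀ i, l i z₀ ≤ d i) {r : ℝ} (hr : 0 < r) :
    ∃ e : Plane ≃ Plane, IsDiffeo e ∧ (∀ z, (¬ ∀ i, l i z < d i + ε) → e z = z) ∧
      {z | ∀ i, l i z ≤ d i} ⊆ e '' Metric.ball z₀ r ∧
      ∃ μ : ℝ, e =ᶠ[𝓝 z₀] fun z => z₀ + μ • (z - z₀) := by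
  obtain ⟨D, hD⟩ := hb.subset_closedBall z₀
  -- Small enough for the homothety of ratio κ to take the whole polytope into the disc of radius
  -- `r`; the inflation is the inverse.
  obtain ⟨κ, hκ, hκlt⟩ := exists_between (lt_min one_pos (div_pos hr (by positivity : 0 < |D| + 1)))
  obtain ⟨hκ1, hκr⟩ := lt_min_iff.1 hκlt
  let lam := polytopeCutoff l d ε
  have hle : ∀ z, lam z ≤ 1 := polytopeCutoff_le_one
  have hanti := fun w => antitoneOn_polytopeCutoff hε hz₀ w
  let k : Plane ≃ Plane := Equiv.ofBijective (contraction z₀ κ lam)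
    ⟨injective_contraction hκ hκ1 hle hanti,
      surjective_contraction contDiff_polytopeCutoff.continuous hκ hκ1 hle⟩
  have hk : IsDiffeo k := IsDiffeo.of_contDiff (contDiff_contraction contDiff_polytopeCutoff)
    fun z => det_fderiv_contraction_pos contDiff_polytopeCutoff hκ hκ1 hle hanti z
  have hk1 : ∀ z, (∀ i, l i z ≤ d i + ε / 2) → k z = z₀ + κ • (z - z₀) := fun z hz => by
    change contraction z₀ κ (polytopeCutoff l d ε) z = _
    rw [contraction, polytopeCutoff_eq_one hε hz]
    congr 2; ring
  refine ⟨k.symm, hk.symm, fun z hz => ?_, fun z hz => ?_, κ⁻¹, ?_⟩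
  · rw [Equiv.symm_apply_eq]
    change z = contraction z₀ κ (polytopeCutoff l d ε) z
    rw [contraction, polytopeCutoff_eq_zero hε hz]
    simp
  · refine ⟨k z, ?_, k.symm_apply_apply z⟩
    rw [hk1 z fun i => (hz i).trans (by linarith), mem_ball_iff_norm, add_sub_cancel_left, norm_smul,
      Real.norm_of_nonneg hκ.le]
    have h1 : ‖z - z₀‖ < |D| + 1 :=
      ((mem_closedBall_iff_norm.1 (hD hz)).trans (le_abs_self D)).trans_lt (lt_add_one _)
    rw [lt_div_iff₀ (by positivity)] at hκr
    exact (mul_lt_mul_of_pos_left h1 hκ).trans hκr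
  · have hopen : ∀ᶠ z in 𝓝 z₀, ∀ i, l i (z₀ + κ⁻¹ • (z - z₀)) < d i + ε / 2 := by
      refine Filter.eventually_all.2 fun i => ?_
      have hc : Continuous fun z : Plane => l i (z₀ + κ⁻¹ • (z - z₀)) := by fun_prop
      refine hc.continuousAt.eventually_lt continuousAt_const ?_
      simpa using (hz₀ i).trans_lt (by linarith)
    filter_upwards [hopen] with z hz
    rw [Equiv.symm_apply_eq, hk1 _ fun i => (hz i).le, add_sub_cancel_left, smul_smul,
      mul_inv_cancel₀ hκ.ne', one_smul, add_sub_cancel]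

end Polytope

/-! ### Rectangles and segments as polytopes -/

/-- A closed rectangle, possibly degenerate, with corner `o`, edge directions `u`, `v` and side
lengths `a`, `b`. -/
def rect (o u v : Plane) (a b : ℝ) : Set Plane :=
  {z | ∃ s ∈ Set.Icc 0 a, ∃ t ∈ Set.Icc 0 b, z = o + s • u + t • v}

theorem isCompact_rect (o u v : Plane) (a b : ℝ) : IsCompact (rect o u v a b) := by
  have : rect o u v a b =
      (fun x : ℝ × ℝ => o + x.1 • u + x.2 • v) '' (Set.Icc 0 a ×ˢ Set.Icc 0 b) := by
    ext z
    simp only [rect, Set.mem_ofPred_eq, Set.mem_image, Set.mem_prod, Prod.exists]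
    constructor
    · rintro ⟨s, hs, t, ht, rfl⟩; exact ⟨s, t, ⟨hs, ht⟩, rfl⟩
    · rintro ⟨s, t, ⟨hs, ht⟩, rfl⟩; exact ⟨s, hs, t, ht, rfl⟩
  rw [this]
  exact (isCompact_Icc.prod isCompact_Icc).image (by fun_prop)

section Rect

variable {o u v : Plane} {a b : ℝ}

theorem eq_of_orthonormal (hu : ‖u‖ = 1) (hv : ‖v‖ = 1) (huv : inner ℝ u v = 0) (w : Plane) :
    w = inner ℝ u w • u + inner ℝ v w • v := by
  have ho : Orthonormal ℝ ![u, v] := by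
    refine ⟨fun i => by fin_cases i <;> simp [hu, hv], fun i j hij => ?_⟩
    fin_cases i <;> fin_cases j <;> simp_all [real_inner_comm]
  let B := basisOfOrthonormalOfCardEqFinrank ho (by simp)
  have hB : ⇑B = ![u, v] := coe_basisOfOrthonormalOfCardEqFinrank ho (by simp)
  let OB := B.toOrthonormalBasis (by rwa [hB])
  have := (OB.sum_repr' w).symm
  simpa [Fin.sum_univ_two, OB, hB] using this

theorem mem_rect_iff (hu : ‖u‖ = 1) (hv : ‖v‖ = 1) (huv : inner ℝ u v = 0) {z : Plane} :
    z ∈ rect o u v a b ↔ inner ℝ u (z - o) ∈ Set.Icc 0 a ∧ inner ℝ v (z - o) ∈ Set.Icc 0 b := by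
  constructor
  · rintro ⟨s, hs, t, ht, rfl⟩
    have h : o + s • u + t • v - o = s • u + t • v := by abel
    have hvu : inner ℝ v u = 0 := by rw [real_inner_comm, huv]
    rw [h, inner_add_right, inner_add_right, inner_smul_right, inner_smul_right, inner_smul_right,
      inner_smul_right, huv, hvu, real_inner_self_eq_norm_sq, real_inner_self_eq_norm_sq, hu, hv]
    simpa using ⟨hs, ht⟩
  · rintro ⟨hs, ht⟩
    refine ⟨_, hs, _, ht, ?_⟩
    rw [add_assoc, ← eq_of_orthonormal hu hv huv, add_sub_cancel]

/-- Inflation of discs inside a rectangle, with support in a neighbourhood independent of the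
disc. -/
theorem exists_inflation_rect (hu : ‖u‖ = 1) (hv : ‖v‖ = 1) (huv : inner ℝ u v = 0)
    (ha : 0 ≤ a) (hb : 0 ≤ b) {ε : ℝ} (hε : 0 < ε) :
    ∃ W : Set Plane, IsOpen W ∧ rect o u v a b ⊆ W ∧
      W ⊆ Metric.thickening ε (rect o u v a b) ∧
      ∀ z₀ ∈ rect o u v a b, ∀ r > 0, ∃ e : Plane ≃ Plane, IsDiffeo e ∧ (∀ z ∉ W, e z = z) ∧
        rect o u v a b ⊆ e '' Metric.ball z₀ r ∧
        ∃ μ : ℝ, e =ᶠ[𝓝 z₀] fun z => z₀ + μ • (z - z₀) := by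
  let l : Fin 4 → Plane →L[ℝ] ℝ := ![innerSL ℝ u, -innerSL ℝ u, innerSL ℝ v, -innerSL ℝ v]
  let d : Fin 4 → ℝ := ![a + inner ℝ u o, -inner ℝ u o, b + inner ℝ v o, -inner ℝ v o]
  have hK : rect o u v a b = {z | ∀ i, l i z ≤ d i} := by
    ext z
    rw [mem_rect_iff hu hv huv]
    simp only [Set.mem_Icc, Set.mem_ofPred_eq, Fin.forall_fin_succ, inner_sub_right]
    simp [l, d]
    constructor
    · rintro ⟨⟨h1, h2⟩, h3, h4⟩; exact ⟨h2, h1, h4, h3⟩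
    · rintro ⟨h1, h2, h3, h4⟩; exact ⟨⟨h2, h1⟩, h4, h3⟩
  -- Clamping each of the two coordinates moves it by less than ε/2, for a total below ε.
  have hε2 : 0 < ε / 2 := half_pos hε
  refine ⟨{z | ∀ i, l i z < d i + ε / 2}, ?_, ?_, ?_, ?_⟩
  · rw [Set.ofPred_forall]
    exact isOpen_iInter_of_finite fun i => isOpen_lt (l i).continuous continuous_const
  · rw [hK]
    exact fun z hz i => (hz i).trans_lt (by linarith)
  · intro z hz
    have hs1 : inner ℝ u (z - o) < a + ε / 2 := by
      have := hz 0; simp [l, d] at this; rw [inner_sub_right]; linarith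
    have hs2 : -(ε / 2) < inner ℝ u (z - o) := by
      have := hz 1; simp [l, d] at this; rw [inner_sub_right]; linarith
    have ht1 : inner ℝ v (z - o) < b + ε / 2 := by
      have := hz 2; simp [l, d] at this; rw [inner_sub_right]; linarith
    have ht2 : -(ε / 2) < inner ℝ v (z - o) := by
      have := hz 3; simp [l, d] at this; rw [inner_sub_right]; linarith
    have hclamp : ∀ {x c : ℝ}, 0 ≤ c → x < c + ε / 2 → -(ε / 2) < x →
        ∃ y ∈ Set.Icc 0 c, |x - y| < ε / 2 := fun {x c} hc h1 h2 => by
      rcases lt_or_ge x 0 with h | h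
      · exact ⟨0, ⟨le_rfl, hc⟩, by rw [abs_lt]; constructor <;> linarith⟩
      rcases lt_or_ge c x with h' | h'
      · exact ⟨c, ⟨hc, le_rfl⟩, by rw [abs_lt]; constructor <;> linarith⟩
      · exact ⟨x, ⟨h, h'⟩, by simpa using hε⟩
    obtain ⟨s, hs, hs'⟩ := hclamp ha hs1 hs2
    obtain ⟨t, ht, ht'⟩ := hclamp hb ht1 ht2
    refine Metric.mem_thickening_iff.2 ⟨o + s • u + t • v, ⟨s, hs, t, ht, rfl⟩, ?_⟩
    have hdiff : z - (o + s • u + t • v) =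
        (inner ℝ u (z - o) - s) • u + (inner ℝ v (z - o) - t) • v := by
      rw [sub_smul, sub_smul]
      nth_rewrite 1 [show z = o + (z - o) by abel, eq_of_orthonormal hu hv huv (z - o)]
      abel
    rw [dist_eq_norm, hdiff]
    calc _ ≤ |inner ℝ u (z - o) - s| + |inner ℝ v (z - o) - t| := by
          refine (norm_add_le _ _).trans ?_
          simp [norm_smul, hu, hv]
      _ < ε := by linarith
  · intro z₀ hz₀ r hr
    have hbd : Bornology.IsBounded {z | ∀ i, l i z ≤ d i} := hK ▸ (isCompact_rect o u v a b).isBounded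
    rw [hK] at hz₀ ⊢
    exact exists_diffeo_polytope hε2 hbd hz₀ hr

end Rect

/-! ### From a diffeomorphism to an area preserving map -/

theorem contDiff_det_fderiv {f : Plane → Plane} (hf : ContDiff ℝ ∞ f) :
    ContDiff ℝ ∞ fun z => (fderiv ℝ f z).det := by
  have h : ∀ (v : Plane) (i : Fin 2), ContDiff ℝ ∞ fun z => fderiv ℝ f z v i := fun v i =>
    (contDiff_coord i).comp ((hf.fderiv_right (m := ∞) (by simp)).clm_apply contDiff_const)
  simp only [det_eq_wedge, wedge]
  exact ((h _ 0).mul (h _ 1)).sub ((h _ 1).mul (h _ 0))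

theorem volume_image_eq_lintegral {f : Plane → Plane} (hf : Differentiable ℝ f)
    (hinj : Function.Injective f) {s : Set Plane} (hs : MeasurableSet s) :
    MeasureTheory.volume (f '' s) = ∫⁻ z in s, ENNReal.ofReal |(fderiv ℝ f z).det| :=
  (MeasureTheory.lintegral_abs_det_fderiv_eq_addHaar_image _ hs
    (fun z _ => (hf z).hasFDerivAt.hasFDerivWithinAt) hinj.injOn).symm

/-- A diffeomorphism of the plane can be composed with a rearrangement of the source so that it
becomes area preserving and still maps centred discs to images of centred discs. -/
theorem exists_areaPreserving_of_diffeo {G : Plane ≃ Plane} (hG : IsDiffeo G)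
    (hconst : ∀ᶠ z in 𝓝 (0 : Plane), fderiv ℝ G z = fderiv ℝ G 0) :
    ∃ (σ : Plane → Plane) (U : Set Plane), IsOpen U ∧ ContDiffOn ℝ ∞ σ U ∧ Set.InjOn σ U ∧
      (∀ z ∈ U, (fderiv ℝ σ z).det = 1) ∧
      ∀ R ≥ 0, ∀ A : ℝ, ENNReal.ofReal A ≤ MeasureTheory.volume (G '' Metric.closedBall 0 R) →
        Metric.closedBall 0 (Real.sqrt (A / Real.pi)) ⊆ U ∧
        Set.MapsTo σ (Metric.closedBall 0 (Real.sqrt (A / Real.pi)))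
          (G '' Metric.closedBall 0 R) := by
  let J : Plane → ℝ := fun z => (fderiv ℝ G z).det
  have hJ : ContDiff ℝ ∞ J := contDiff_det_fderiv hG.contDiff
  have hpos : ∀ z, 0 < J z := hG.det_pos
  have hM := contDiffAt_det_rearrange hJ hpos (by
    filter_upwards [hconst] with z hz
    simp only [J, hz])
  set M := rearrange J
  have hMinj : Function.Injective M := injective_rearrange hJ hpos
  have hMdet : ∀ z, (fderiv ℝ M z).det ≠ 0 := fun z => by rw [(hM z).2]; exact (hpos z).ne'
  let g := Function.invFun M
  have hg : Function.LeftInverse g M := Function.leftInverse_invFun hMinj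
  have hσM : ∀ z, (G ∘ g) (M z) = G z := fun z => by simp [hg z]
  have hgs : ∀ z, ContDiffAt ℝ ∞ g (M z) := fun z => contDiffAt_leftInverse hg (hM z).1 (hMdet z)
  refine ⟨G ∘ g, Set.range M, ?_, ?_, ?_, ?_, ?_⟩
  · rw [isOpen_iff_mem_nhds]
    rintro _ ⟨z, rfl⟩
    simpa using image_mem_nhds_of_det_ne_zero (hM z).1 (hMdet z) Filter.univ_mem
  · rintro _ ⟨z, rfl⟩
    exact (hG.contDiff.contDiffAt.comp _ (hgs z)).contDiffWithinAt
  · rintro _ ⟨z, rfl⟩ _ ⟨w, rfl⟩ h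
    rw [hσM, hσM] at h
    rw [G.injective h]
  · rintro _ ⟨z, rfl⟩
    have h := det_fderiv_leftInverse hg (hM z).1 (hMdet z)
    rw [fderiv_comp _ (hG.differentiable _) ((hgs z).differentiableAt (by simp)), det_comp, hg z]
    rwa [(hM z).2, mul_comm] at h
  · intro R hR A hA
    -- Both areas are the integral of `J` over the disc, as G and M have the same Jacobian
    -- determinant.
    have hvol : MeasureTheory.volume (G '' Metric.closedBall 0 R) =
        MeasureTheory.volume (Metric.closedBall (0 : Plane) (newRadius J R)) := by
      rw [← image_closedBall_rearrange hJ hpos hR,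
        volume_image_eq_lintegral hG.differentiable G.injective measurableSet_closedBall,
        volume_image_eq_lintegral (fun z => (hM z).1.differentiableAt (by simp)) hMinj
          measurableSet_closedBall]
      simp only [M, (hM _).2, J]
    have hr := newRadius_nonneg (J := J) R
    have hle : Real.sqrt (A / Real.pi) ≤ newRadius J R := by
      rw [hvol, EuclideanSpace.volume_closedBall_fin_two, ← ENNReal.ofReal_pow hr,
        ← ENNReal.ofReal_mul (by positivity), ENNReal.ofReal_le_ofReal_iff (by positivity)] at hA
      refine Real.sqrt_le_iff.2 ⟨hr, ?_⟩
      rwa [div_le_iff₀ Real.pi_pos]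
    have hsub : Metric.closedBall (0 : Plane) (Real.sqrt (A / Real.pi)) ⊆
        M '' Metric.closedBall 0 R := by
      rw [image_closedBall_rearrange hJ hpos hR]
      exact Metric.closedBall_subset_closedBall hle
    refine ⟨hsub.trans (Set.image_subset_range _ _), fun w hw => ?_⟩
    obtain ⟨z, hz, rfl⟩ := hsub hw
    exact ⟨z, hz, (hσM z).symm⟩

/-! ### The dumbbell diffeomorphism -/

theorem exists_unit_orthogonal (u : Plane) (hu : ‖u‖ = 1) :
    ∃ v : Plane, ‖v‖ = 1 ∧ inner ℝ u v = 0 := by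
  refine ⟨!₂[-u 1, u 0], ?_, ?_⟩
  · rw [← abs_norm, ← abs_one, ← sq_eq_sq_iff_abs_eq_abs, norm_sq_plane]
    have := norm_sq_plane u
    rw [hu] at this
    simp
    linarith
  · simp [PiLp.inner_apply, Fin.sum_univ_two]
    ring

/-- Treating a segment as a rectangle of width zero makes stretching along it a case of inflation.
-/
theorem exists_rect_eq_segment {p q : Plane} (hpq : p ≠ q) :
    ∃ (u v : Plane) (a : ℝ), ‖u‖ = 1 ∧ ‖v‖ = 1 ∧ inner ℝ u v = 0 ∧ 0 ≤ a ∧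
      rect p u v a 0 = segment ℝ p q := by
  have ha : 0 < ‖q - p‖ := norm_pos_iff.2 (sub_ne_zero.2 hpq.symm)
  have hu : ‖‖q - p‖⁻¹ • (q - p)‖ = 1 := by
    rw [norm_smul, norm_inv, norm_norm, inv_mul_cancel₀ ha.ne']
  obtain ⟨v, hv, huv⟩ := exists_unit_orthogonal _ hu
  refine ⟨_, v, ‖q - p‖, hu, hv, huv, ha.le, ?_⟩
  rw [segment_eq_image']
  ext z
  constructor
  · rintro ⟨s, hs, t, ht, rfl⟩
    refine ⟨s * ‖q - p‖⁻¹, ⟨mul_nonneg hs.1 (inv_nonneg.2 ha.le), ?_⟩, ?_⟩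
    · rw [← div_eq_mul_inv]
      exact (div_le_one ha).2 hs.2
    · have : t = 0 := le_antisymm ht.2 ht.1
      simp [this, mul_smul]
  · rintro ⟨θ, hθ, rfl⟩
    refine ⟨θ * ‖q - p‖, ⟨mul_nonneg hθ.1 ha.le, ?_⟩, 0, ⟨le_rfl, le_rfl⟩, ?_⟩
    · nlinarith [hθ.2]
    · simp [smul_smul, mul_assoc, mul_inv_cancel₀ ha.ne']

/-- On a segment leaving a compact set `A`, one can start arbitrarily soon after the last point of
`A`. -/
theorem exists_last_exit {A O : Set Plane} (hA : IsCompact A) (hO : IsOpen O) (hAO : A ⊆ O)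
    {p q : Plane} (hp : p ∈ A) (hq : q ∉ A) :
    ∃ x ∈ O, x ≠ q ∧ segment ℝ x q ⊆ segment ℝ p q ∧ Disjoint (segment ℝ x q) A := by
  let γ : ℝ → Plane := AffineMap.lineMap p q
  have hγ : Continuous γ := AffineMap.lineMap_continuous
  have hseg : ∀ a ∈ Set.Icc (0 : ℝ) 1, segment ℝ (γ a) q = γ '' Set.Icc a 1 := fun a ha => by
    have h1 : q = γ 1 := by simp [γ]
    rw [← segment_eq_Icc ha.2]
    conv_lhs => rw [h1]
    exact (image_segment ℝ (AffineMap.lineMap p q : ℝ →ᵃ[ℝ] Plane) a 1).symm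
  -- The last time in `A`; a slightly later point is still in the open set `O`.
  obtain ⟨τ, ⟨⟨hτ0, hτ1⟩, hτA⟩, hmax⟩ :=
    (isCompact_Icc.inter_right (hA.isClosed.preimage hγ) :
      IsCompact (Set.Icc (0 : ℝ) 1 ∩ γ ⁻¹' A)).exists_isGreatest
      ⟨0, ⟨le_rfl, zero_le_one⟩, by simpa [γ] using hp⟩
  have hτlt : τ < 1 := lt_of_le_of_ne hτ1 fun h => hq (by simpa [γ, h] using hτA)
  have hev : ∀ᶠ t in 𝓝[>] τ, γ t ∈ O :=
    (hγ.continuousAt.eventually (hO.mem_nhds (hAO hτA))).filter_mono nhdsWithin_le_nhds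
  obtain ⟨t, htO, ht⟩ := (hev.and (Ioo_mem_nhdsGT hτlt)).exists
  have ht01 : t ∈ Set.Icc (0 : ℝ) 1 := ⟨hτ0.trans ht.1.le, ht.2.le⟩
  have hdisj : Disjoint (segment ℝ (γ t) q) A := by
    rw [hseg t ht01, Set.disjoint_left]
    rintro _ ⟨s, hs, rfl⟩ hsA
    have : s ≤ τ := hmax ⟨⟨ht01.1.trans hs.1, hs.2⟩, hsA⟩
    linarith [ht.1, hs.1]
  have hpγ : segment ℝ p q = γ '' Set.Icc 0 1 := by
    have := hseg 0 ⟨le_rfl, zero_le_one⟩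
    simpa [γ] using this
  refine ⟨γ t, htO, ?_, ?_, hdisj⟩
  · intro h
    have hpq : p ≠ q := fun h => hq (h ▸ hp)
    have h1 : γ t = γ 1 := by simpa [γ] using h
    exact ht.2.ne (AffineMap.lineMap_injective ℝ hpq h1)
  · rw [hseg t ht01, hpγ]
    exact Set.image_mono (Set.Icc_subset_Icc_left ht01.1)

/-- A diffeomorphism of the plane taking a disc to a neighbourhood of one rectangle and a larger
disc to a neighbourhood of the union of two disjoint rectangles and a segment joining them. -/
theorem exists_diffeo_dumbbell {o₁ u₁ v₁ o₂ u₂ v₂ p q : Plane} {a₁ b₁ a₂ b₂ ε : ℝ}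
    (hu₁ : ‖u₁‖ = 1) (hv₁ : ‖v₁‖ = 1) (huv₁ : inner ℝ u₁ v₁ = 0) (ha₁ : 0 ≤ a₁) (hb₁ : 0 ≤ b₁)
    (hu₂ : ‖u₂‖ = 1) (hv₂ : ‖v₂‖ = 1) (huv₂ : inner ℝ u₂ v₂ = 0) (ha₂ : 0 ≤ a₂) (hb₂ : 0 ≤ b₂)
    (hdisj : Disjoint (rect o₁ u₁ v₁ a₁ b₁) (rect o₂ u₂ v₂ a₂ b₂))
    (hp : p ∈ rect o₁ u₁ v₁ a₁ b₁) (hq : q ∈ rect o₂ u₂ v₂ a₂ b₂) (hε : 0 < ε) :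
    ∃ G : Plane ≃ Plane, IsDiffeo G ∧
      (∀ᶠ z in 𝓝 (0 : Plane), fderiv ℝ G z = fderiv ℝ G 0) ∧
      ∃ R₁ ≥ 0, ∃ R₂ ≥ 0,
        rect o₁ u₁ v₁ a₁ b₁ ⊆ G '' Metric.closedBall 0 R₁ ∧
        G '' Metric.closedBall 0 R₁ ⊆ Metric.thickening ε (rect o₁ u₁ v₁ a₁ b₁) ∧
        rect o₁ u₁ v₁ a₁ b₁ ∪ rect o₂ u₂ v₂ a₂ b₂ ⊆ G '' Metric.closedBall 0 R₂ ∧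
        G '' Metric.closedBall 0 R₂ ⊆ Metric.thickening ε (rect o₁ u₁ v₁ a₁ b₁) ∪
          Metric.thickening ε (segment ℝ p q ∪ rect o₂ u₂ v₂ a₂ b₂) := by
  set P₁ := rect o₁ u₁ v₁ a₁ b₁
  set P₂ := rect o₂ u₂ v₂ a₂ b₂
  have hc₁ : IsCompact P₁ := isCompact_rect ..
  have hc₂ : IsCompact P₂ := isCompact_rect ..
  obtain ⟨δ, hδ, hδdisj⟩ := hdisj.exists_thickenings hc₁ hc₂.isClosed
  obtain ⟨W₁, hW₁o, hPW₁, hW₁, hinfl₁⟩ :=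
    exists_inflation_rect (o := o₁) hu₁ hv₁ huv₁ ha₁ hb₁ (lt_min hδ hε)
  obtain ⟨W₂, hW₂o, hPW₂, hW₂, hinfl₂⟩ :=
    exists_inflation_rect (o := o₂) hu₂ hv₂ huv₂ ha₂ hb₂ (lt_min hδ hε)
  have hW₁₂ : Disjoint W₁ W₂ := hδdisj.mono
    (hW₁.trans (Metric.thickening_mono (min_le_left _ _) _))
    (hW₂.trans (Metric.thickening_mono (min_le_left _ _) _))
  -- The disc of half this radius is inflated over P₁; the surrounding annulus supplies the material
  -- for the segment and P₂.
  obtain ⟨R₂, hR₂, hR₂W⟩ := Metric.nhds_basis_closedBall.mem_iff.1 (hW₁o.mem_nhds (hPW₁ hp))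
  have hR₁ : 0 < R₂ / 2 := half_pos hR₂
  obtain ⟨E₁, hE₁, hE₁id, hE₁P, μ, hμ⟩ := hinfl₁ p hp _ hR₁
  have hE₁W : Set.MapsTo E₁ W₁ W₁ := mapsTo_of_eq_outside hE₁id
  set A := E₁ '' Metric.closedBall p (R₂ / 2) with hAdef
  have hballs : Metric.closedBall p (R₂ / 2) ⊆ Metric.ball p R₂ :=
    Metric.closedBall_subset_ball (half_lt_self hR₂)
  have hA : IsCompact A := (isCompact_closedBall _ _).image hE₁.contDiff.continuous
  have hAW : A ⊆ W₁ := (hE₁W.mono_left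
    ((hballs.trans Metric.ball_subset_closedBall).trans hR₂W)).image_subset
  have hPA : P₁ ⊆ A := hE₁P.trans (Set.image_mono Metric.ball_subset_closedBall)
  have hOo : IsOpen (E₁ '' Metric.ball p R₂) := hE₁.isOpen_image Metric.isOpen_ball
  -- The stretching starts in the image of the annulus, past `A`, so that its support can avoid `A`
  -- and leave the inner image unchanged.
  obtain ⟨x, hxO, hxq, hxseg, hxA⟩ := exists_last_exit hA hOo (Set.image_mono hballs) (hPA hp)
    (fun h => Set.disjoint_left.1 hW₁₂ (hAW h) (hPW₂ hq))
  obtain ⟨u, v, a, hu, hv, huv, ha, hrect⟩ := exists_rect_eq_segment hxq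
  obtain ⟨δ', hδ', hδ'disj⟩ := hxA.exists_thickenings (hrect ▸ isCompact_rect x u v a 0) hA.isClosed
  obtain ⟨W, -, -, hWsub, hinfl⟩ :=
    exists_inflation_rect (o := x) hu hv huv ha le_rfl (lt_min hδ' hε)
  rw [hrect] at hWsub hinfl
  have hWA : Disjoint W A := hδ'disj.mono
    (hWsub.trans (Metric.thickening_mono (min_le_left _ _) _)) (Metric.self_subset_thickening hδ' A)
  obtain ⟨r, hr, hrO⟩ := Metric.isOpen_iff.1 hOo x hxO
  obtain ⟨S, hS, hSid, hSseg, -⟩ := hinfl x (left_mem_segment ℝ x q) r hr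
  have hSW : Set.MapsTo S W W := mapsTo_of_eq_outside hSid
  -- After the stretching, the image of the outer disc contains a disc about `q`, which is then
  -- inflated over P₂.
  obtain ⟨r', hr', hr'O⟩ := Metric.isOpen_iff.1 (hS.isOpen_image hOo) q
    (Set.image_mono hrO (hSseg (right_mem_segment ℝ x q)))
  obtain ⟨E₂, hE₂, hE₂id, hE₂P, -⟩ := hinfl₂ q hq r' hr'
  have hE₂W : Set.MapsTo E₂ W₂ W₂ := mapsTo_of_eq_outside hE₂id
  let G : Plane ≃ Plane := (Equiv.addLeft p).trans (E₁.trans (S.trans E₂))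
  have hGapply : ∀ z, G z = E₂ (S (E₁ (p + z))) := fun z => rfl
  have hGA : ∀ z, E₁ (p + z) ∈ A → G z = E₁ (p + z) := fun z hz => by
    rw [hGapply, hSid _ (Set.disjoint_right.1 hWA hz), hE₂id _ (Set.disjoint_left.1 hW₁₂ (hAW hz))]
  have himage : ∀ (f : Plane → Plane) (R : ℝ), (fun z => f (p + z)) '' Metric.closedBall 0 R =
      f '' Metric.closedBall p R := fun f R => by
    have h := (IsometryEquiv.addLeft p).image_closedBall 0 R
    rw [IsometryEquiv.addLeft_apply, add_zero] at h
    rw [← h, Set.image_image]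
    rfl
  have hG₁ : G '' Metric.closedBall 0 (R₂ / 2) = A := by
    rw [hAdef, ← himage]
    refine Set.image_congr fun z hz => hGA z ⟨_, ?_, rfl⟩
    simpa using hz
  have hG₂ : G '' Metric.closedBall 0 R₂ =
      (fun z => E₂ (S (E₁ z))) '' Metric.closedBall p R₂ :=
    himage (fun z => E₂ (S (E₁ z))) R₂
  refine ⟨G, (IsDiffeo.translation p).trans (hE₁.trans (hS.trans hE₂)), ?_, R₂ / 2, hR₁.le, R₂,
    hR₂.le, ?_, ?_, ?_, ?_⟩
  · have htend : Filter.Tendsto (fun z : Plane => p + z) (𝓝 0) (𝓝 p) := by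
      simpa using (continuous_const_add p).tendsto 0
    have h1 : G =ᶠ[𝓝 0] fun z => p + μ • z := by
      filter_upwards [htend.eventually hμ,
        htend.eventually (Metric.closedBall_mem_nhds p hR₁)] with z hz hzb
      rw [hGA z ⟨_, hzb, rfl⟩, hz, add_sub_cancel_left]
    have h2 : ∀ z : Plane, fderiv ℝ (fun z : Plane => p + μ • z) z =
        μ • ContinuousLinearMap.id ℝ Plane := fun z =>
      ((μ • ContinuousLinearMap.id ℝ Plane).hasFDerivAt.const_add p).fderiv
    have h3 := h1.fderiv (𝕜 := ℝ)
    filter_upwards [h3] with z hz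
    rw [hz, h3.self_of_nhds, h2, h2]
  · rw [hG₁]; exact hPA
  · rw [hG₁]; exact (hAW.trans hW₁).trans (Metric.thickening_mono (min_le_right _ _) _)
  · refine Set.union_subset ?_ ?_
    · refine hPA.trans (hG₁ ▸ Set.image_mono (Metric.closedBall_subset_closedBall ?_))
      linarith
    · refine hE₂P.trans ((Set.image_mono hr'O).trans ?_)
      rw [hG₂, Set.image_image, Set.image_image]
      exact Set.image_mono Metric.ball_subset_closedBall
  · rw [hG₂]
    rintro _ ⟨z, hz, rfl⟩
    have hP₂sub : W₂ ⊆ Metric.thickening ε (segment ℝ p q ∪ P₂) :=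
      (hW₂.trans (Metric.thickening_mono (min_le_right _ _) _)).trans
        (Metric.thickening_subset_of_subset _ Set.subset_union_right)
    have hWsub' : W ⊆ Metric.thickening ε (segment ℝ p q ∪ P₂) :=
      (hWsub.trans (Metric.thickening_mono (min_le_right _ _) _)).trans
        (Metric.thickening_subset_of_subset _ (hxseg.trans Set.subset_union_left))
    have h1 : E₁ z ∈ W₁ := hE₁W (hR₂W hz)
    -- A point can leave `W₁` only inside the support of `S`, and after that can move only inside
    -- that of `E₂`.
    have h2 : S (E₁ z) ∈ W₁ ∪ W := by
      by_cases h : E₁ z ∈ W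
      · exact Or.inr (hSW h)
      · rw [hSid _ h]; exact Or.inl h1
    by_cases h : S (E₁ z) ∈ W₂
    · exact Or.inr (hP₂sub (hE₂W h))
    · change E₂ (S (E₁ z)) ∈ _
      rw [hE₂id _ h]
      rcases h2 with h2 | h2
      · exact Or.inl (Metric.thickening_mono (min_le_right _ _) _ (hW₁ h2))
      · exact Or.inr (hWsub' h2)

/-! ### The planar embedding -/

/-- The planar version: an area preserving embedding of a disc of area `C` into a neighbourhood of
two rectangles joined by a segment, taking the concentric disc of area `C - c` near the first. -/
theorem exists_planar_embedding {c C ε : ℝ} (hc : 0 < c) (hcC : c < C) {P₁ P₂ : Set Plane}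
    (hP₁ : IsRectangle P₁) (hP₂ : IsRectangle P₂)
    (area₁ : MeasureTheory.volume P₁ = ENNReal.ofReal (C - c))
    (area₂ : MeasureTheory.volume P₂ = ENNReal.ofReal c) (hdisj : Disjoint P₁ P₂)
    {p q : Plane} (hp : p ∈ P₁) (hq : q ∈ P₂) (hε : 0 < ε) :
    ∃ (σ : Plane → Plane) (U : Set Plane), IsOpen U ∧ ContDiffOn ℝ ∞ σ U ∧ Set.InjOn σ U ∧
      (∀ z ∈ U, (fderiv ℝ σ z).det = 1) ∧
      Metric.closedBall 0 (Real.sqrt (C / Real.pi)) ⊆ U ∧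
      Set.MapsTo σ (Metric.closedBall 0 (Real.sqrt ((C - c) / Real.pi)))
        (Metric.thickening ε P₁) ∧
      Set.MapsTo σ (Metric.closedBall 0 (Real.sqrt (C / Real.pi)))
        (Metric.thickening ε P₁ ∪ Metric.thickening ε (segment ℝ p q ∪ P₂)) := by
  obtain ⟨o₁, u₁, v₁, a₁, b₁, hu₁, hv₁, huv₁, ha₁, hb₁, hP₁⟩ := hP₁
  obtain ⟨o₂, u₂, v₂, a₂, b₂, hu₂, hv₂, huv₂, ha₂, hb₂, hP₂⟩ := hP₂
  change P₁ = rect o₁ u₁ v₁ a₁ b₁ at hP₁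
  change P₂ = rect o₂ u₂ v₂ a₂ b₂ at hP₂
  subst hP₁ hP₂
  obtain ⟨G, hG, hconst, R₁, hR₁, R₂, hR₂, h1, h2, h3, h4⟩ := exists_diffeo_dumbbell hu₁ hv₁ huv₁
    ha₁.le hb₁.le hu₂ hv₂ huv₂ ha₂.le hb₂.le hdisj hp hq hε
  obtain ⟨σ, U, hU, hσ, hinj, hdet, hball⟩ := exists_areaPreserving_of_diffeo hG hconst
  have hA₁ := hball R₁ hR₁ (C - c) (area₁ ▸ MeasureTheory.measure_mono h1)
  have hA₂ := hball R₂ hR₂ C (by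
    refine le_trans (le_of_eq ?_) (MeasureTheory.measure_mono h3)
    rw [MeasureTheory.measure_union hdisj (isCompact_rect ..).measurableSet, area₁, area₂,
      ← ENNReal.ofReal_add (by linarith) hc.le, sub_add_cancel])
  exact ⟨σ, U, hU, hσ, hinj, hdet, hA₂.1, hA₁.2.mono_right h2, hA₂.2.mono_right h4⟩

/-! ### Products with the identity of ℝ²ⁿ -/

variable {n : ℕ}

/-- `fstProj` as a continuous linear map. -/
def fstL (n : ℕ) : Phase (n + 1) →L[ℝ] Phase n :=
  LinearMap.toContinuousLinearMap
    { toFun := fstProj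
      map_add' := fun _ _ => rfl
      map_smul' := fun _ _ => rfl }

/-- `sndProj` as a continuous linear map. -/
def sndL (n : ℕ) : Phase (n + 1) →L[ℝ] Plane :=
  LinearMap.toContinuousLinearMap
    { toFun := sndProj
      map_add' := fun _ _ => rfl
      map_smul' := fun _ _ => rfl }

/-- The identification of `ℝ²ⁿ × ℝ²` with `ℝ²ⁿ⁺²`. -/
def join (x : Phase n × Plane) : Phase (n + 1) :=
  WithLp.toLp 2 fun k => Fin.lastCases (motive := fun _ => ℝ) (x.2 k.2) (fun i => x.1 (i, k.2)) k.1

@[simp] theorem join_castSucc (x : Phase n × Plane) (i : Fin n) (j : Fin 2) :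
    join x (i.castSucc, j) = x.1 (i, j) := by simp [join]

@[simp] theorem join_last (x : Phase n × Plane) (j : Fin 2) :
    join x (Fin.last n, j) = x.2 j := by simp [join]

theorem ext_phase {z w : Phase (n + 1)} (h1 : ∀ i j, z (Fin.castSucc i, j) = w (i.castSucc, j))
    (h2 : ∀ j, z (Fin.last n, j) = w (Fin.last n, j)) : z = w := by
  ext ⟨i, j⟩
  induction i using Fin.lastCases with
  | last => exact h2 j
  | cast i => exact h1 i j

/-- `join` as a continuous linear map. -/
def joinL (n : ℕ) : Phase n × Plane →L[ℝ] Phase (n + 1) :=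
  LinearMap.toContinuousLinearMap
    { toFun := join
      map_add' := fun _ _ => ext_phase (by simp) (by simp)
      map_smul' := fun _ _ => ext_phase (by simp) (by simp) }

theorem fstProj_join (x : Phase n × Plane) : fstProj (join x) = x.1 := by
  ext k; simp [fstProj]

theorem sndProj_join (x : Phase n × Plane) : sndProj (join x) = x.2 := by
  ext j; simp [sndProj]

theorem join_proj (z : Phase (n + 1)) : join (fstProj z, sndProj z) = z :=
  ext_phase (by simp [fstProj]) (by simp [sndProj])

theorem omega_eq_add (u v : Phase (n + 1)) :
    omega u v = omega (fstProj u) (fstProj v) + wedge (sndProj u) (sndProj v) := by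
  simp [omega, Fin.sum_univ_castSucc, fstProj, sndProj, wedge]
  ring

theorem norm_sq_eq_add (z : Phase (n + 1)) : ‖z‖ ^ 2 = ‖fstProj z‖ ^ 2 + ‖sndProj z‖ ^ 2 := by
  simp only [EuclideanSpace.norm_sq_eq, Fintype.sum_prod_type, Fin.sum_univ_castSucc (n := n)]
  simp [fstProj, sndProj]

/-- The product of the identity of `ℝ²ⁿ` and a map of the plane. -/
def prodMap (n : ℕ) (σ : Plane → Plane) (z : Phase (n + 1)) : Phase (n + 1) :=
  join (fstProj z, σ (sndProj z))

theorem isSymplecticEmbeddingOn_prodMap {σ : Plane → Plane} {U : Set Plane} (hU : IsOpen U)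
    (hσ : ContDiffOn ℝ ∞ σ U) (hinj : Set.InjOn σ U) (hdet : ∀ z ∈ U, (fderiv ℝ σ z).det = 1)
    {S : Set (Phase (n + 1))} (hS : ∀ z ∈ S, sndProj z ∈ U) :
    IsSymplecticEmbeddingOn (prodMap n σ) S := by
  refine ⟨sndProj ⁻¹' U, hU.preimage (sndL n).continuous, hS, ?_, ?_, ?_⟩
  · exact (joinL n).contDiff.comp_contDiffOn ((fstL n).contDiff.contDiffOn.prodMk
      (hσ.comp (sndL n).contDiff.contDiffOn fun _ hz => hz))
  · intro z hz w hw h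
    have h1 : fstProj z = fstProj w := by
      simpa [prodMap, fstProj_join] using congrArg fstProj h
    have h2 : σ (sndProj z) = σ (sndProj w) := by
      simpa [prodMap, sndProj_join] using congrArg sndProj h
    rw [← join_proj z, ← join_proj w, h1, hinj hz hw h2]
  · intro z hz u v
    have hd : HasFDerivAt σ (fderiv ℝ σ (sndProj z)) (sndL n z) :=
      ((hσ.contDiffAt (hU.mem_nhds hz)).differentiableAt (by simp)).hasFDerivAt
    have hf : HasFDerivAt (prodMap n σ)
        ((joinL n).comp ((fstL n).prod ((fderiv ℝ σ (sndProj z)).comp (sndL n)))) z :=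
      (joinL n).hasFDerivAt.comp z ((fstL n).hasFDerivAt.prodMk (hd.comp z (sndL n).hasFDerivAt))
    have happ : ∀ w, fderiv ℝ (prodMap n σ) z w =
        join (fstProj w, fderiv ℝ σ (sndProj z) (sndProj w)) := fun w => by rw [hf.fderiv]; rfl
    rw [happ, happ, omega_eq_add, fstProj_join, fstProj_join, sndProj_join, sndProj_join,
      wedge_map, hdet _ hz, one_mul, ← omega_eq_add]

/-- The tube lemma for a product of compact sets. Only the planar factor needs thickening, since the
embedding leaves the other coordinates fixed. -/
theorem exists_thickening_of_mem_nhdsSet {K : Set (Phase n)} {P : Set Plane} (hK : IsCompact K)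
    (hP : IsCompact P) {N : Set (Phase (n + 1))} (hN : N ∈ 𝓝ˢ (prodSet K P)) :
    ∃ ε > 0, ∀ z, fstProj z ∈ K → sndProj z ∈ Metric.thickening ε P → z ∈ N := by
  have hmaps : Set.MapsTo (joinL n) (K ×ˢ P) (prodSet K P) := fun x hx =>
    ⟨(fstProj_join x).symm ▸ hx.1, (sndProj_join x).symm ▸ hx.2⟩
  have h := ((joinL n).continuous.tendsto_nhdsSet hmaps) hN
  rw [Filter.mem_map, hK.nhdsSet_prod_eq hP] at h
  obtain ⟨A, hA, B, hB, hAB⟩ := Filter.mem_prod_iff.1 h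
  obtain ⟨ε, hε, hεB⟩ := (Metric.hasBasis_nhdsSet_thickening hP).mem_iff.1 hB
  refine ⟨ε, hε, fun z hz hz' => ?_⟩
  rw [← join_proj z]
  exact hAB (show (fstProj z, sndProj z) ∈ A ×ˢ B from ⟨subset_of_mem_nhdsSet hA hz, hεB hz'⟩)

theorem isRectangle_isCompact {P : Set Plane} (h : IsRectangle P) : IsCompact P := by
  obtain ⟨o, u, v, a, b, -, -, -, -, -, hP⟩ := h
  rw [hP]
  exact isCompact_rect o u v a b

theorem mem_ball_iff {m : ℕ} {a : ℝ} (ha : 0 ≤ a) {z : Phase m} :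
    z ∈ ball m a ↔ ‖z‖ ^ 2 ≤ a / Real.pi := by
  rw [ball, mem_closedBall_zero_iff, Real.le_sqrt (norm_nonneg z) (div_nonneg ha Real.pi_pos.le)]

end

end SymplecticBall

/-! ### Assembly -/

open SymplecticBall in
theorem lemma2p1 (n : ℕ) (c C : ℝ) (hc : 0 < c) (hcC : c < C)
    (P₁ P₂ : Set SymplecticBall.Plane)
    (hP₁ : SymplecticBall.IsRectangle P₁) (hP₂ : SymplecticBall.IsRectangle P₂)
    (area₁ : MeasureTheory.volume P₁ = ENNReal.ofReal (C - c))
    (area₂ : MeasureTheory.volume P₂ = ENNReal.ofReal c)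
    (hdisj : Disjoint P₁ P₂)
    (p q : SymplecticBall.Plane) (hp : p ∈ P₁) (hq : q ∈ P₂)
    (N : Set (SymplecticBall.Phase (n + 1)))
    (hN : N ∈ 𝓝ˢ (SymplecticBall.splitSet n C c P₁ (segment ℝ p q) P₂)) :
    ∃ f : SymplecticBall.Phase (n + 1) → SymplecticBall.Phase (n + 1),
      SymplecticBall.IsSymplecticEmbeddingOn f (SymplecticBall.ball (n + 1) C) ∧
      Set.MapsTo f (SymplecticBall.ball (n + 1) C) N := by
  have hC : 0 < C := hc.trans hcC
  rw [splitSet, nhdsSet_union, Filter.mem_sup] at hN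
  have hseg : IsCompact (segment ℝ p q) := by
    rw [segment_eq_image_lineMap]
    exact isCompact_Icc.image AffineMap.lineMap_continuous
  obtain ⟨ε₁, hε₁, hN₁⟩ := exists_thickening_of_mem_nhdsSet (isCompact_closedBall _ _)
    (isRectangle_isCompact hP₁) hN.1
  obtain ⟨ε₂, hε₂, hN₂⟩ := exists_thickening_of_mem_nhdsSet (isCompact_closedBall _ _)
    (hseg.union (isRectangle_isCompact hP₂)) hN.2
  obtain ⟨σ, U, hU, hσ, hinj, hdet, hCU, hsmall, hlarge⟩ :=
    exists_planar_embedding hc hcC hP₁ hP₂ area₁ area₂ hdisj hp hq (lt_min hε₁ hε₂)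
  have hle : ∀ z ∈ ball (n + 1) C, ‖fstProj z‖ ^ 2 + ‖sndProj z‖ ^ 2 ≤ C / Real.pi :=
    fun z hz => norm_sq_eq_add z ▸ (mem_ball_iff hC.le).1 hz
  have hsnd : ∀ z ∈ ball (n + 1) C,
      sndProj z ∈ Metric.closedBall 0 (Real.sqrt (C / Real.pi)) := fun z hz => by
    rw [mem_closedBall_zero_iff]
    exact Real.le_sqrt_of_sq_le (by nlinarith [hle z hz, sq_nonneg ‖fstProj z‖])
  refine ⟨prodMap n σ, isSymplecticEmbeddingOn_prodMap hU hσ hinj hdet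
    fun z hz => hCU (hsnd z hz), fun z hz => ?_⟩
  have hfst : fstProj z ∈ ball n C :=
    (mem_ball_iff hC.le).2 (by nlinarith [hle z hz, sq_nonneg ‖sndProj z‖])
  have near₁ : σ (sndProj z) ∈ Metric.thickening (min ε₁ ε₂) P₁ → prodMap n σ z ∈ N := fun h =>
    hN₁ _ (by rw [prodMap, fstProj_join]; exact hfst)
      (by rw [prodMap, sndProj_join]; exact Metric.thickening_mono (min_le_left _ _) _ h)
  -- Outside the inner disc the planar part uses more than `C - c` of the capacity, leaving less
  -- than `c` for the other factor.
  by_cases hz' : sndProj z ∈ Metric.closedBall 0 (Real.sqrt ((C - c) / Real.pi))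
  · exact near₁ (hsmall hz')
  · rcases hlarge (hsnd z hz) with h | h
    · exact near₁ h
    · rw [mem_closedBall_zero_iff, Real.le_sqrt (norm_nonneg _)
        (div_nonneg (sub_nonneg.2 hcC.le) Real.pi_pos.le), not_le, sub_div] at hz'
      refine hN₂ _ ?_ ?_
      · rw [prodMap, fstProj_join]
        exact (mem_ball_iff hc.le).2 (by linarith [hle z hz])
      · rw [prodMap, sndProj_join]
        exact Metric.thickening_mono (min_le_right _ _) _ h
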